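/- Let $n$ be a positive integer, and let $$N_{14}(n)=\#\Big\{(x_1,\dots,x_8)\in\mathbb Z^8:\ n=x_1^2+x_1x_2+x_2^2+x_3^2+x_3x_4+x_4^2+14\,(x_5^2+x_5x_6+x_6^2+x_7^2+x_7x_8+x_8^2)\Big\}.$$ Let $\eta(z)=e^{\pi i z/12}\prod_{m\ge1}(1-e^{2\pi i m z})$ be the Dedekind eta function on the upper half plane, put $q=e^{2\pi i z}$, and define the integers $c_k(m)$ by $C_k(q)=\sum_{m\ge1}c_k(m)q^m$, where $$\begin{aligned} C_2&=\eta^2(z)\eta^2(2z)\eta^2(7z)\eta^2(14z), & C_3&=\frac{\eta^6(z)\eta^6(14z)}{\eta^2(2z)\eta^2(7z)},\\ C_4&=\frac{\eta^6(2z)\eta^6(7z)}{\eta^2(z)\eta^2(14z)}, & C_5&=\eta^2(z)\eta^2(2z)\eta^2(3z)\eta^2(6z),\\ C_6&=\eta(2z)\eta^3(3z)\eta(7z)\eta^3(42z), & C_7&=\eta(z)\eta^3(6z)\eta(14z)\eta^3(21z),\\ C_8&=\eta^2(7z)\eta^2(14z)\eta^2(21z)\eta^2(42z), & C_{10}&=\eta^2(2z)\eta^2(6z)\eta^2(7z)\eta^2(21z),\\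 C_{12}&=\eta^3(z)\eta(6z)\eta^3(14z)\eta(21z), & C_{17}&=\frac{\eta^6(6z)\eta^6(21z)}{\eta^2(3z)\eta^2(42z)},\\ C_{19}&=\eta^2(3z)\eta^2(6z)\eta^2(21z)\eta^2(42z). \end{aligned}$$ Let $\sigma_3(m)=\sum_{d\mid m}d^3$ for a positive integer $m$, and read $\sigma_3(n/t)$ and $c_k(n/t)$ as $0$ when $t\nmid n$. Then $$\begin{aligned} N_{14}(n)={}&\tfrac{12}{125}\sigma_3(n)+\tfrac{48}{125}\sigma_3(\tfrac n2)+\tfrac{108}{125}\sigma_3(\tfrac n3)+\tfrac{432}{125}\sigma_3(\tfrac n6)+\tfrac{588}{125}\sigma_3(\tfrac n7)+\tfrac{2352}{125}\sigma_3(\tfrac n{14})\\ &+\tfrac{5292}{125}\sigma_3(\tfrac n{21})+\tfrac{21168}{125}\sigma_3(\tfrac n{42})+\tfrac{288}{25}c_2(n)-\tfrac{6}{25}c_3(n)+\tfrac{294}{25}c_4(n)\\ &+\tfrac{2592}{175}c_2(\tfrac n3)-\tfrac{54}{25}c_3(\tfrac n3)-\tfrac{5778}{175}c_4(\tfrac n3)+\tfrac{18}{125}c_5(n)-\tfrac{648}{5}c_6(n)+\tfrac{2484}{25}c_7(n)\\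 &+\tfrac{882}{125}c_8(n)-\tfrac{1296}{25}c_{10}(n)-\tfrac{252}{25}c_{12}(n)+\tfrac{972}{7}c_{17}(n)+\tfrac{15552}{175}c_{19}(n). \end{aligned}$$ -/

import Mathlib

open scoped UpperHalfPlane

noncomputable section

/-- The number `N_l(n)` of `x ∈ ℤ⁸` with
`n = x₁² + x₁x₂ + x₂² + x₃² + x₃x₄ + x₄² + l (x₅² + x₅x₆ + x₆² + x₇² + x₇x₈ + x₈²)`
(the coordinates are indexed from `0`). -/
def repNumber (l n : ℕ) : ℕ :=
  Set.ncard {x : Fin 8 → ℤ |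
    (n : ℤ) = x 0 ^ 2 + x 0 * x 1 + x 1 ^ 2 + x 2 ^ 2 + x 2 * x 3 + x 3 ^ 2
      + (l : ℤ) * (x 4 ^ 2 + x 4 * x 5 + x 5 ^ 2 + x 6 ^ 2 + x 6 * x 7 + x 7 ^ 2)}

/-- `f (n / t)`, read as `0` when `n / t` is not an integer. -/
def atQuot (f : ℕ → ℂ) (n t : ℕ) : ℂ :=
  if t ∣ n then f (n / t) else 0

/-- `σ₃(n) = ∑_{d ∣ n} d³`, as a complex number. -/
def sigma3 (n : ℕ) : ℂ := (ArithmeticFunction.sigma 3 n : ℕ)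

/-- `z ↦ η(δ z)` on the upper half plane, `η` being the Dedekind eta function. -/
def etaAt (δ : ℕ) (z : ℍ) : ℂ := ModularForm.eta ((δ : ℂ) * (z : ℂ))

/-- The coefficient of `qⁿ`, `q = exp (2πiz)`, in the Fourier expansion of `f`. -/
def fourierCoeffAt (f : ℍ → ℂ) (n : ℕ) : ℂ :=
  (UpperHalfPlane.qExpansion 1 f).coeff n

def etaC2 (z : ℍ) : ℂ := etaAt 1 z ^ 2 * etaAt 2 z ^ 2 * etaAt 7 z ^ 2 * etaAt 14 z ^ 2

def etaC3 (z : ℍ) : ℂ := etaAt 1 z ^ 6 * etaAt 14 z ^ 6 / (etaAt 2 z ^ 2 * etaAt 7 z ^ 2)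

def etaC4 (z : ℍ) : ℂ := etaAt 2 z ^ 6 * etaAt 7 z ^ 6 / (etaAt 1 z ^ 2 * etaAt 14 z ^ 2)

def etaC5 (z : ℍ) : ℂ := etaAt 1 z ^ 2 * etaAt 2 z ^ 2 * etaAt 3 z ^ 2 * etaAt 6 z ^ 2

def etaC6 (z : ℍ) : ℂ := etaAt 2 z * etaAt 3 z ^ 3 * etaAt 7 z * etaAt 42 z ^ 3

def etaC7 (z : ℍ) : ℂ := etaAt 1 z * etaAt 6 z ^ 3 * etaAt 14 z * etaAt 21 z ^ 3

def etaC8 (z : ℍ) : ℂ := etaAt 7 z ^ 2 * etaAt 14 z ^ 2 * etaAt 21 z ^ 2 * etaAt 42 z ^ 2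

def etaC10 (z : ℍ) : ℂ := etaAt 2 z ^ 2 * etaAt 6 z ^ 2 * etaAt 7 z ^ 2 * etaAt 21 z ^ 2

def etaC12 (z : ℍ) : ℂ := etaAt 1 z ^ 3 * etaAt 6 z * etaAt 14 z ^ 3 * etaAt 21 z

def etaC17 (z : ℍ) : ℂ := etaAt 6 z ^ 6 * etaAt 21 z ^ 6 / (etaAt 3 z ^ 2 * etaAt 42 z ^ 2)

def etaC19 (z : ℍ) : ℂ := etaAt 3 z ^ 2 * etaAt 6 z ^ 2 * etaAt 21 z ^ 2 * etaAt 42 z ^ 2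

/-! `c2`, `c3`, ...: the coefficients `c_k(n)` in `C_k(q) = ∑_{n ≥ 1} c_k(n) qⁿ`. -/

def c2 : ℕ → ℂ := fourierCoeffAt etaC2

def c3 : ℕ → ℂ := fourierCoeffAt etaC3

def c4 : ℕ → ℂ := fourierCoeffAt etaC4

def c5 : ℕ → ℂ := fourierCoeffAt etaC5

def c6 : ℕ → ℂ := fourierCoeffAt etaC6

def c7 : ℕ → ℂ := fourierCoeffAt etaC7

def c8 : ℕ → ℂ := fourierCoeffAt etaC8

def c10 : ℕ → ℂ := fourierCoeffAt etaC10

def c12 : ℕ → ℂ := fourierCoeffAt etaC12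

def c17 : ℕ → ℂ := fourierCoeffAt etaC17

def c19 : ℕ → ℂ := fourierCoeffAt etaC19

end

/-! The theta series of the octonary form is `θ(z)² θ(14z)²`, where `θ` is the theta series of `x² +
xy + y²`. Both sides of the identity are Fourier coefficients of weight 4 modular forms, so it is
enough to show that a form `defect` vanishes; this follows from a Sturm bound and a finite
computation.

Modularity has three sources. Poisson summation in each variable gives the inversion `z ↦ -1/(3z)`
of `θ`, and with it `θ² ∈ M₂(Γ₀(3))`, so the theta series has level 42 (`isModForm_octTheta`). The
Eisenstein part is a combination of the `E₄(tz)`, `t ∣ 42`. For eta quotients, the multiplier of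
`η²` is a power of `exp (2πi/12)` whose exponent is a polynomial in the matrix entries
(`etaSq_slash`). For quotients of even exponents, invariance under `Γ₀(42)` is thus a finite check
modulo 3 and 4, and boundedness at the cusps is a finite check over the divisors of 42
(`isModForm_etaQuot`).

The forms `C₆`, `C₇`, `C₁₂` have odd exponents, and only their squares are covered. A holomorphic
function whose square is invariant is itself invariant up to sign, so `C₆` and `C₇` are modular on a
subgroup `levelGroup` of index at most 4 in `Γ₀(42)`. The quotient `C₁₂ / C₇` has even exponents, so
`C₁₂` needs no further subgroup. The total index is at most `4 · 96 = 384`, and in weight 4 the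
vanishing of the first 129 coefficients suffices (`IsModForm.eq_zero_of_isBigO`).

For these coefficients, `defect` is multiplied by `∏ E(q^δ)²`, with `E` the Euler product. This
clears all eta denominators, and the truncated product is an integer polynomial expression in sparse
series. Kronecker substitution at `2 ^ 192` turns the vanishing of 129 coefficients into one
divisibility of integers (`defectExpr_valueAt`). The multiplier has constant term 1, hence is a unit
in power series and can be removed. -/

namespace Level42

open UpperHalfPlane Filter Asymptotics Function Topology
open scoped MatrixGroups ModularForm Manifold Real
open CongruenceSubgroup (Gamma0)

/-! ### Expansions in `q` as convergent power series on the unit disc -/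

/-- `f` is the sum of the power series `p` in `q = exp (2πiτ)`. -/
def HasQExp (f : ℍ → ℂ) (p : PowerSeries ℂ) : Prop :=
  ∀ τ : ℍ, HasSum (fun m ↦ p.coeff m * Periodic.qParam 1 (τ : ℂ) ^ m) (f τ)

theorem norm_qParam_lt_one (τ : ℍ) : ‖Periodic.qParam 1 (τ : ℂ)‖ < 1 :=
  Periodic.norm_qParam_lt_one one_pos τ.im_pos

theorem exists_qParam_eq {q : ℂ} (hq : ‖q‖ < 1) (hq0 : q ≠ 0) :
    ∃ τ : ℍ, Periodic.qParam 1 (τ : ℂ) = q :=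
  ⟨⟨Periodic.invQParam 1 q, Periodic.im_invQParam_pos_of_norm_lt_one one_pos hq hq0⟩,
    by exact_mod_cast Periodic.qParam_right_inv one_ne_zero hq0⟩

namespace HasQExp

variable {f g : ℍ → ℂ} {p r : PowerSeries ℂ}

theorem add (hf : HasQExp f p) (hg : HasQExp g r) : HasQExp (fun τ ↦ f τ + g τ) (p + r) :=
  fun τ ↦ by simpa [add_mul] using (hf τ).add (hg τ)

theorem sub (hf : HasQExp f p) (hg : HasQExp g r) : HasQExp (fun τ ↦ f τ - g τ) (p - r) :=
  fun τ ↦ by simpa [sub_mul] using (hf τ).sub (hg τ)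

theorem const_mul (c : ℂ) (hf : HasQExp f p) :
    HasQExp (fun τ ↦ c * f τ) (PowerSeries.C c * p) :=
  fun τ ↦ by simpa [mul_assoc] using (hf τ).mul_left c

theorem mul (hf : HasQExp f p) (hg : HasQExp g r) : HasQExp (fun τ ↦ f τ * g τ) (p * r) := by
  intro τ
  have h1 := (hf τ).summable.norm
  have h2 := (hg τ).summable.norm
  have h3 := (summable_norm_sum_mul_antidiagonal_of_summable_norm h1 h2).of_norm.hasSum
  rw [← tsum_mul_tsum_eq_tsum_sum_antidiagonal_of_summable_norm h1 h2, (hf τ).tsum_eq,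
    (hg τ).tsum_eq] at h3
  convert! h3 using 2 with n
  rw [PowerSeries.coeff_mul, Finset.sum_mul]
  refine Finset.sum_congr rfl fun x hx ↦ ?_
  rw [← Finset.HasAntidiagonal.mem_antidiagonal.mp hx, pow_add]
  ring

theorem one : HasQExp (fun _ ↦ 1) 1 := fun τ ↦ by
  convert hasSum_ite_eq (0 : ℕ) (1 : ℂ) using 2 with m
  rw [PowerSeries.coeff_one]
  split_ifs with h <;> simp [h]

theorem pow (hf : HasQExp f p) (n : ℕ) : HasQExp (fun τ ↦ f τ ^ n) (p ^ n) := by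
  induction n with
  | zero => simpa using one
  | succ n ih => simpa [pow_succ] using ih.mul hf

theorem qParam_pow (k : ℕ) : HasQExp (fun τ ↦ Periodic.qParam 1 (τ : ℂ) ^ k) (PowerSeries.X ^ k) :=
  fun τ ↦ by
    convert hasSum_ite_eq k (Periodic.qParam 1 (τ : ℂ) ^ k) using 2 with m
    rw [PowerSeries.coeff_X_pow]
    split_ifs with h <;> simp [h]

theorem congr {f' : ℍ → ℂ} (hf : HasQExp f p) (h : ∀ τ, f τ = f' τ) : HasQExp f' p := by
  rwa [← funext h]

/-- Every nonzero `q` in the unit disc is `exp (2πiτ)` for some `τ` in the upper half plane, so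
convergence at all `τ` makes the radius of convergence at least 1. -/
theorem hasFPowerSeriesOnBall (hf : HasQExp f p) :
    HasFPowerSeriesOnBall (fun q ↦ ∑' m, p.coeff m * q ^ m) (.ofScalars ℂ fun m ↦ p.coeff m)
      0 1 := by
  have key {q : ℂ} (hq : ‖q‖ < 1) : Summable fun m ↦ p.coeff m * q ^ m := by
    rcases eq_or_ne q 0 with rfl | h0
    · exact summable_of_ne_finset_zero (s := {0}) fun m hm ↦ by
        simp [zero_pow (by simpa using hm : m ≠ 0)]
    · obtain ⟨τ, rfl⟩ := exists_qParam_eq hq h0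
      exact (hf τ).summable
  refine ⟨?_, by simp, fun {y} hy ↦ ?_⟩
  · refine le_of_forall_lt_imp_le_of_dense fun s hs ↦ ?_
    lift s to NNReal using hs.ne_top
    apply FormalMultilinearSeries.le_radius_of_summable
    have := (key (q := s) (by simpa using hs)).norm
    simpa [mul_comm] using this
  · rw [← ENNReal.coe_one, Metric.eball_coe, NNReal.coe_one, mem_ball_zero_iff] at hy
    simpa [mul_comm] using (key hy).hasSum

theorem isBigO_of_coeff_eq_zero (hf : HasQExp f p) {N : ℕ} (h : ∀ m < N, p.coeff m = 0) :
    f =O[atImInfty] fun τ ↦ Periodic.qParam 1 (τ : ℂ) ^ N := by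
  have h1 := hf.hasFPowerSeriesOnBall.hasFPowerSeriesAt.isBigO_sub_partialSum_pow N
  have h2 : ∀ y : ℂ, (FormalMultilinearSeries.ofScalars ℂ fun m ↦ p.coeff m).partialSum N y = 0 :=
    fun y ↦ Finset.sum_eq_zero fun m hm ↦ by
      simp [h m (Finset.mem_range.mp hm)]
  simp only [zero_add, h2, sub_zero] at h1
  have h3 := h1.comp_tendsto (qParam_tendsto_atImInfty one_pos)
  refine (IsBigO.congr_left h3 fun τ ↦ (hf τ).tsum_eq).trans (.of_bound 1 (.of_forall fun τ ↦ ?_))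
  simp

/-- If the coefficients below `m` vanish, the series minus its `m`-th term is `O(q^(m+1))`. For `m <
N` the `m`-th term is then `O(q^(m+1))` as well, so its coefficient is a constant of size `O(q)`,
hence zero. With `N` arbitrary this also gives uniqueness of expansions. -/
theorem coeff_eq_zero_of_isBigO (hf : HasQExp f p) {N : ℕ}
    (h : f =O[atImInfty] fun τ ↦ Periodic.qParam 1 (τ : ℂ) ^ N) : ∀ m < N, p.coeff m = 0 := by
  intro m
  induction m using Nat.strong_induction_on with | _ m ih
  intro hm
  have h1 : (fun τ : ℍ ↦ f τ - p.coeff m * Periodic.qParam 1 (τ : ℂ) ^ m) =O[atImInfty]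
      fun τ ↦ Periodic.qParam 1 (τ : ℂ) ^ (m + 1) := by
    refine (hf.sub ((qParam_pow m).const_mul (p.coeff m))).isBigO_of_coeff_eq_zero fun i hi ↦ ?_
    rcases (Nat.lt_succ_iff_lt_or_eq.mp hi) with h' | rfl
    · simp [PowerSeries.coeff_X_pow, h'.ne, ih i h' (h'.trans hm)]
    · simp
  have hle {a b : ℕ} (hab : a ≤ b) : (fun τ : ℍ ↦ Periodic.qParam 1 (τ : ℂ) ^ b) =O[atImInfty]
      fun τ ↦ Periodic.qParam 1 (τ : ℂ) ^ a :=
    .of_bound 1 <| .of_forall fun τ ↦ by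
      simpa using pow_le_pow_of_le_one (norm_nonneg _) (norm_qParam_lt_one τ).le hab
  have h2 : (fun τ : ℍ ↦ p.coeff m * Periodic.qParam 1 (τ : ℂ) ^ m) =O[atImInfty]
      fun τ ↦ Periodic.qParam 1 (τ : ℂ) ^ (m + 1) := by
    simpa using (h.trans (hle hm)).sub h1
  have h3 : (fun _ : ℍ ↦ p.coeff m) =O[atImInfty] fun τ ↦ Periodic.qParam 1 (τ : ℂ) := by
    obtain ⟨C, hC⟩ := h2.bound
    refine .of_bound C (hC.mono fun τ hτ ↦ ?_)
    rw [pow_succ, norm_mul, norm_mul, mul_comm ‖_ ^ m‖, ← mul_assoc] at hτ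
    exact le_of_mul_le_mul_right hτ
      (norm_pos_iff.mpr (pow_ne_zero _ (Periodic.qParam_ne_zero _)))
  simpa using h3.trans_tendsto (qParam_tendsto_atImInfty one_pos)

theorem unique (hf : HasQExp f p) (hg : HasQExp f r) : p = r := by
  refine sub_eq_zero.mp (PowerSeries.ext fun n ↦ ?_)
  refine (hf.sub hg).coeff_eq_zero_of_isBigO (N := n + 1) ?_ n n.lt_succ_self
  simpa using isBigO_zero _ _

end HasQExp

/-! ### Scalings of the upper half plane and their commutation with `SL(2, ℤ)` -/

/-- `z ↦ δ z` on the upper half plane. -/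
noncomputable def scale (δ : ℕ) [NeZero δ] (z : ℍ) : ℍ :=
  ⟨δ * z, by
    have : (0 : ℝ) < δ := Nat.cast_pos.mpr (NeZero.pos δ)
    simpa using mul_pos this z.im_pos⟩

@[simp] theorem coe_scale (δ : ℕ) [NeZero δ] (z : ℍ) : (scale δ z : ℂ) = δ * z := rfl

/-- `z ↦ (A z + B) / D` on the upper half plane. -/
noncomputable def affineMap (A D : ℕ) (B : ℤ) [NeZero A] [NeZero D] (z : ℍ) : ℍ :=
  ⟨(A * z + B) / D, by
    have hA : (0 : ℝ) < A := Nat.cast_pos.mpr (NeZero.pos A)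
    have hD : (0 : ℝ) < D := Nat.cast_pos.mpr (NeZero.pos D)
    simpa using div_pos (mul_pos hA z.im_pos) hD⟩

@[simp] theorem coe_affineMap (A D : ℕ) (B : ℤ) [NeZero A] [NeZero D] (z : ℍ) :
    (affineMap A D B z : ℂ) = (A * z + B) / D := rfl

theorem im_affineMap (A D : ℕ) (B : ℤ) [NeZero A] [NeZero D] (z : ℍ) :
    (affineMap A D B z).im = A / D * z.im := by
  change (((A : ℂ) * z + B) / D).im = _
  simp
  ring

theorem tendsto_affineMap (A D : ℕ) (B : ℤ) [NeZero A] [NeZero D] :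
    Tendsto (affineMap A D B) atImInfty atImInfty := by
  have hA : (0 : ℝ) < A := Nat.cast_pos.mpr (NeZero.pos A)
  have hD : (0 : ℝ) < D := Nat.cast_pos.mpr (NeZero.pos D)
  rw [atImInfty, tendsto_comap_iff]
  have : UpperHalfPlane.im ∘ affineMap A D B = fun z ↦ (A / D : ℝ) * z.im :=
    funext fun z ↦ im_affineMap A D B z
  rw [this]
  exact Tendsto.const_mul_atTop (div_pos hA hD) tendsto_comap

theorem coe_SL_smul (γ : SL(2, ℤ)) (z : ℍ) :
    ((γ • z : ℍ) : ℂ) = ((γ 0 0 : ℤ) * z + (γ 0 1 : ℤ)) / ((γ 1 0 : ℤ) * z + (γ 1 1 : ℤ)) := by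
  rw [coe_specialLinearGroup_apply]
  simp

theorem denom_SL (γ : SL(2, ℤ)) (z : ℍ) :
    denom γ z = (γ 1 0 : ℤ) * z + (γ 1 1 : ℤ) := by
  simp [denom]

theorem denom_SL_ne_zero (γ : SL(2, ℤ)) (z : ℍ) :
    ((γ 1 0 : ℤ) * z + (γ 1 1 : ℤ) : ℂ) ≠ 0 := by
  rw [← denom_SL]
  exact denom_ne_zero _ z

theorem SL_det (γ : SL(2, ℤ)) : γ 0 0 * γ 1 1 - γ 0 1 * γ 1 0 = 1 := by
  rw [← Matrix.det_fin_two]; exact γ.2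

/-- Hermite normal form: `diag(δ, 1) γ = γ' (A B; 0 D)` with `γ'` of determinant one. The value `A =
gcd(δ, c)` determines the order of `f(δz)` at the cusp `γ∞`. -/
theorem exists_scale_smul (δ : ℕ) [NeZero δ] (γ : SL(2, ℤ)) :
    ∃ (A D : ℕ) (B : ℤ) (_ : NeZero A) (_ : NeZero D) (γ' : SL(2, ℤ)),
      A = Nat.gcd δ (γ 1 0).natAbs ∧ A * D = δ ∧ ∀ z : ℍ,
        scale δ (γ • z) = γ' • affineMap A D B z ∧
        denom γ z = D * denom γ' (affineMap A D B z) := by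
  obtain ⟨A, hA⟩ : ∃ A, A = Nat.gcd δ (γ 1 0).natAbs := ⟨_, rfl⟩
  have hδ : 0 < δ := NeZero.pos δ
  have hA0 : 0 < A := hA ▸ Nat.gcd_pos_of_pos_left _ hδ
  obtain ⟨D, hD⟩ : A ∣ δ := hA ▸ Nat.gcd_dvd_left _ _
  have hD0 : 0 < D := Nat.pos_of_ne_zero (by rintro rfl; simp at hD; omega)
  obtain ⟨c, hc⟩ : (A : ℤ) ∣ γ 1 0 :=
    Int.natCast_dvd.mpr (hA ▸ Nat.gcd_dvd_right _ _)
  have hdet := SL_det γ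
  have hcop : IsCoprime (D : ℤ) c := by
    have h : Int.gcd (A * D) (A * c) = A := by
      rw [← hc, show (A : ℤ) * D = δ by exact_mod_cast hD.symm]
      exact hA.symm
    rw [Int.gcd_mul_left] at h
    rw [Int.isCoprime_iff_gcd_eq_one]
    simpa using Nat.eq_of_mul_eq_mul_left hA0 (by simpa using h)
  have hcop' : IsCoprime (γ 0 0) c := ⟨γ 1 1, -(A * γ 0 1), by rw [hc] at hdet; linarith⟩
  obtain ⟨y, x, hxy⟩ := hcop.mul_left hcop'
  set γ' : SL(2, ℤ) := ⟨!![D * γ 0 0, -x; c, y], by rw [Matrix.det_fin_two_of]; linarith⟩ with hγ'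
  have : NeZero A := ⟨hA0.ne'⟩
  have : NeZero D := ⟨hD0.ne'⟩
  -- This is the upper right entry of `γ'⁻¹ diag(δ, 1) γ`.
  refine ⟨A, D, y * δ * γ 0 1 + x * γ 1 1, ‹_›, ‹_›, γ', hA, hD.symm, fun z ↦ ?_⟩
  have hDC : (D : ℂ) ≠ 0 := by exact_mod_cast hD0.ne'
  have e1 : ((γ 0 0 : ℤ) : ℂ) * (γ 1 1 : ℤ) - (γ 0 1 : ℤ) * (γ 1 0 : ℤ) = 1 := by
    exact_mod_cast hdet
  have e2 : (y : ℂ) * (D * (γ 0 0 : ℤ)) + x * c = 1 := by exact_mod_cast hxy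
  have e3 : ((γ 1 0 : ℤ) : ℂ) = A * c := by rw [hc]; push_cast; rfl
  have e4 : (δ : ℂ) = A * D := by rw [hD]; push_cast; rfl
  have hne := denom_SL_ne_zero γ z
  have hden : denom γ z = D * denom γ' (affineMap A D (y * δ * γ 0 1 + x * γ 1 1) z) := by
    rw [denom_SL, denom_SL]
    simp only [hγ', Matrix.SpecialLinearGroup.coe_mk, Matrix.of_apply, Matrix.cons_val',
      Matrix.cons_val_zero,
      Matrix.cons_val_one, Matrix.cons_val_fin_one, coe_affineMap]
    push_cast
    field_simp
    rw [e3] at e1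
    rw [e3, e4]
    linear_combination (D * y : ℂ) * e1 - ((γ 1 1 : ℤ) : ℂ) * e2
  refine ⟨?_, hden⟩
  rw [denom_SL, denom_SL] at hden
  apply UpperHalfPlane.ext
  rw [coe_scale, coe_SL_smul, coe_SL_smul]
  simp only [hγ', Matrix.SpecialLinearGroup.coe_mk, Matrix.of_apply, Matrix.cons_val',
      Matrix.cons_val_zero,
      Matrix.cons_val_one, Matrix.cons_val_fin_one, coe_affineMap] at hden ⊢
  have hnum : (δ : ℂ) * ((γ 0 0 : ℤ) * z + (γ 0 1 : ℤ)) = D * (((D * γ 0 0 : ℤ) : ℂ) *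
      ((A * z + (y * δ * γ 0 1 + x * γ 1 1 : ℤ)) / D) + ((-x : ℤ) : ℂ)) := by
    push_cast
    field_simp
    rw [e3] at e1
    rw [e4]
    linear_combination -(D * x : ℂ) * e1 - (D * A * (γ 0 1 : ℤ) : ℂ) * e2
  rw [mul_div_assoc', hnum, hden, mul_div_mul_left _ _ hDC]

theorem scale_smul_of_dvd (δ : ℕ) [NeZero δ] {γ γ' : SL(2, ℤ)} (h00 : γ' 0 0 = γ 0 0)
    (h01 : γ' 0 1 = δ * γ 0 1) (h10 : δ * γ' 1 0 = γ 1 0) (h11 : γ' 1 1 = γ 1 1) (z : ℍ) :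
    scale δ (γ • z) = γ' • scale δ z ∧ denom γ' (scale δ z) = denom γ z := by
  have h : denom γ' (scale δ z) = denom γ z := by
    rw [denom_SL, denom_SL, ← h10, h11, coe_scale]
    push_cast; ring
  refine ⟨UpperHalfPlane.ext ?_, h⟩
  rw [denom_SL, denom_SL] at h
  rw [coe_SL_smul, h, coe_scale, coe_SL_smul, h00, h01, coe_scale]
  push_cast
  ring

/-- The conjugate of `γ` by `z ↦ δ z`, for `δ` dividing the lower left entry. -/
theorem exists_conj (δ : ℕ) {γ : SL(2, ℤ)} (h : (δ : ℤ) ∣ γ 1 0) :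
    ∃ γ' : SL(2, ℤ), γ' 0 0 = γ 0 0 ∧ γ' 0 1 = δ * γ 0 1 ∧ δ * γ' 1 0 = γ 1 0 ∧
      γ' 1 1 = γ 1 1 := by
  obtain ⟨c, hc⟩ := h
  refine ⟨⟨!![γ 0 0, δ * γ 0 1; c, γ 1 1], ?_⟩, by simp, by simp, by simp [hc], by simp⟩
  rw [Matrix.det_fin_two_of]
  have := SL_det γ
  rw [hc] at this
  linarith

/-! ### Modular forms as a property of functions -/

/-- A modular form of weight `k` on `Γ`, as a property of functions. -/
structure IsModForm (Γ : Subgroup SL(2, ℤ)) (k : ℤ) (f : ℍ → ℂ) : Prop where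
  holo : MDiff f
  slash : ∀ γ ∈ Γ, f ∣[k] γ = f
  bdd : ∀ γ : SL(2, ℤ), IsBoundedAtImInfty (f ∣[k] γ)

namespace IsModForm

variable {Γ Γ' : Subgroup SL(2, ℤ)} {k l : ℤ} {f g : ℍ → ℂ}

theorem mono (hf : IsModForm Γ k f) (h : Γ' ≤ Γ) : IsModForm Γ' k f :=
  ⟨hf.holo, fun γ hγ ↦ hf.slash γ (h hγ), hf.bdd⟩

theorem add (hf : IsModForm Γ k f) (hg : IsModForm Γ k g) : IsModForm Γ k (f + g) :=
  ⟨hf.holo.add hg.holo, fun γ hγ ↦ by rw [SlashAction.add_slash, hf.slash γ hγ, hg.slash γ hγ],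
    fun γ ↦ by rw [SlashAction.add_slash]; exact (hf.bdd γ).add (hg.bdd γ)⟩

theorem const_smul (c : ℂ) (hf : IsModForm Γ k f) : IsModForm Γ k (c • f) :=
  ⟨hf.holo.const_smul c, fun γ hγ ↦ by rw [ModularForm.SL_smul_slash, hf.slash γ hγ],
    fun γ ↦ by rw [ModularForm.SL_smul_slash]; exact (hf.bdd γ).const_smul_left c⟩

theorem mul (hf : IsModForm Γ k f) (hg : IsModForm Γ l g) : IsModForm Γ (k + l) (f * g) :=
  ⟨hf.holo.mul hg.holo,
    fun γ hγ ↦ by rw [ModularForm.mul_slash_SL2, hf.slash γ hγ, hg.slash γ hγ],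
    fun γ ↦ by rw [ModularForm.mul_slash_SL2]; exact (hf.bdd γ).mul (hg.bdd γ)⟩

end IsModForm

theorem mdifferentiable_scale (δ : ℕ) [NeZero δ] {f : ℍ → ℂ} (hf : MDiff f) :
    MDiff (fun z ↦ f (scale δ z)) := by
  rw [UpperHalfPlane.mdifferentiable_iff] at hf ⊢
  have hδ : (0 : ℝ) < δ := Nat.cast_pos.mpr (NeZero.pos δ)
  have hmap : Set.MapsTo (fun w : ℂ ↦ (δ : ℂ) * w) {z | 0 < z.im} {z | 0 < z.im} := fun w hw ↦ by
    simpa using mul_pos hδ hw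
  refine ((hf.comp (by fun_prop) hmap).congr fun w hw ↦ ?_)
  simp only [comp_apply, ofComplex_apply_of_im_pos hw, ofComplex_apply_of_im_pos (hmap hw)]
  rfl

theorem slash_scale_apply (δ : ℕ) [NeZero δ] (k : ℤ) (f : ℍ → ℂ) {γ γ' : SL(2, ℤ)} {z : ℍ}
    {w : ℍ} {D : ℂ} (h1 : scale δ (γ • z) = γ' • w) (h2 : denom γ z = D * denom γ' w) :
    ((fun z ↦ f (scale δ z)) ∣[k] γ) z = D ^ (-k) * (f ∣[k] γ') w := by
  rw [ModularForm.SL_slash_apply, ModularForm.SL_slash_apply, h1, h2, mul_zpow]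
  ring

theorem bdd_scale (δ : ℕ) [NeZero δ] {k : ℤ} {f : ℍ → ℂ}
    (hf : ∀ γ : SL(2, ℤ), IsBoundedAtImInfty (f ∣[k] γ)) (γ : SL(2, ℤ)) :
    IsBoundedAtImInfty ((fun z ↦ f (scale δ z)) ∣[k] γ) := by
  obtain ⟨A, D, B, _, _, γ', -, -, h⟩ := exists_scale_smul δ γ
  have h1 : ((fun z ↦ f (scale δ z)) ∣[k] γ) =
      fun z ↦ (D : ℂ) ^ (-k) * (f ∣[k] γ') (affineMap A D B z) :=
    funext fun z ↦ slash_scale_apply δ k f (h z).1 (h z).2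
  rw [h1]
  exact ((hf γ').comp_tendsto (tendsto_affineMap A D B)).const_mul_left _

/-- Conjugation by `diag(δ, 1)` sends `Γ₀(δN)` into `Γ₀(N)`, and boundedness at all cusps passes
through the decomposition of `exists_scale_smul`. -/
theorem IsModForm.scale {N M δ : ℕ} [NeZero δ] (hM : δ * N ∣ M) {k : ℤ} {f : ℍ → ℂ}
    (hf : IsModForm (CongruenceSubgroup.Gamma0 N) k f) :
    IsModForm (CongruenceSubgroup.Gamma0 M) k (fun z ↦ f (scale δ z)) := by
  refine ⟨mdifferentiable_scale δ hf.holo, fun γ hγ ↦ ?_, bdd_scale δ hf.bdd⟩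
  have hγM : (M : ℤ) ∣ γ 1 0 := by
    rwa [CongruenceSubgroup.Gamma0_mem, ZMod.intCast_zmod_eq_zero_iff_dvd] at hγ
  have hdvd : (δ : ℤ) * N ∣ γ 1 0 := by
    refine dvd_trans ?_ hγM
    exact_mod_cast hM
  obtain ⟨γ', h00, h01, h10, h11⟩ := exists_conj δ (dvd_of_mul_right_dvd hdvd)
  have hγ' : γ' ∈ CongruenceSubgroup.Gamma0 N := by
    rw [CongruenceSubgroup.Gamma0_mem, ZMod.intCast_zmod_eq_zero_iff_dvd]
    rw [← h10] at hdvd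
    exact (mul_dvd_mul_iff_left (by exact_mod_cast NeZero.ne δ)).mp hdvd
  funext z
  obtain ⟨h1, h2⟩ := scale_smul_of_dvd δ h00 h01 h10 h11 z
  rw [slash_scale_apply δ k f (D := 1) h1 (by rw [h2, one_mul]), hf.slash γ' hγ']
  simp

/-! ### The multiplier system of `η²` -/

/-- The exponent of the multiplier system of `η²`, as a polynomial in the matrix entries. -/
def etaExponent {R : Type*} [CommRing R] (a b c d : R) : R :=
  (1 - c ^ 2) * (b * d + 3 * (c - 1) * d + c + 3) + c * (a + d - 3)

/-- The primitive twelfth root of unity `exp (2πi / 12)`. -/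
noncomputable def zeta12 : ℂ := Complex.exp (2 * π * Complex.I / 12)

theorem zeta12_ne_zero : zeta12 ≠ 0 := Complex.exp_ne_zero _

theorem zeta12_pow : zeta12 ^ (12 : ℤ) = 1 := by
  have := (Complex.isPrimitiveRoot_exp 12 (by norm_num)).pow_eq_one
  simpa [zeta12] using mod_cast this

theorem zeta12_pow_three : zeta12 ^ (3 : ℤ) = Complex.I := by
  rw [zeta12, ← Complex.exp_int_mul,
    show ((3 : ℤ) : ℂ) * (2 * π * Complex.I / 12) = π / 2 * Complex.I by push_cast; ring,
    Complex.exp_pi_div_two_mul_I]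

/-- By the Chinese remainder theorem an exponent modulo 12 is known from its residues modulo 3 and
4. This keeps the exhaustive checks over matrix entries small. -/
theorem zeta12_zpow_eq {m n : ℤ} (h3 : (m : ZMod 3) = n) (h4 : (m : ZMod 4) = n) :
    zeta12 ^ m = zeta12 ^ n := by
  have h3' := (ZMod.intCast_eq_intCast_iff_dvd_sub _ _ _).mp h3
  have h4' := (ZMod.intCast_eq_intCast_iff_dvd_sub _ _ _).mp h4
  obtain ⟨k, hk⟩ : (12 : ℤ) ∣ n - m := by push_cast at h3' h4'; omega
  rw [show n = m + 12 * k by omega, zpow_add₀ zeta12_ne_zero, zpow_mul, zeta12_pow]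
  simp

theorem etaExponent_mul_T : (∀ a b c d : ZMod 3, a * d - b * c = 1 →
      etaExponent a (a + b) c (c + d) = etaExponent a b c d + 1) ∧
    (∀ a b c d : ZMod 4, a * d - b * c = 1 →
      etaExponent a (a + b) c (c + d) = etaExponent a b c d + 1) := by
  unfold etaExponent
  decide +kernel

theorem etaExponent_mul_S : (∀ a b c d : ZMod 3, a * d - b * c = 1 →
      etaExponent b (-a) d (-c) = etaExponent a b c d - 3) ∧
    (∀ a b c d : ZMod 4, a * d - b * c = 1 →
      etaExponent b (-a) d (-c) = etaExponent a b c d - 3) := by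
  unfold etaExponent
  decide +kernel

theorem cast_etaExponent (R : Type*) [CommRing R] (a b c d : ℤ) :
    ((etaExponent a b c d : ℤ) : R) = etaExponent (a : R) b c d := by
  simp [etaExponent]

/-- The multiplier of `η²` at `γ`. -/
noncomputable def etaMult (γ : SL(2, ℤ)) : ℂ :=
  zeta12 ^ etaExponent (γ 0 0) (γ 0 1) (γ 1 0) (γ 1 1)

theorem etaMult_ne_zero (γ : SL(2, ℤ)) : etaMult γ ≠ 0 := zpow_ne_zero _ zeta12_ne_zero

theorem etaMult_mul_T (γ : SL(2, ℤ)) : etaMult (γ * ModularGroup.T) = etaMult γ * zeta12 := by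
  rw [etaMult, etaMult, ← zpow_add_one₀ zeta12_ne_zero]
  have hdet := SL_det γ
  have h3 := congr_arg (Int.cast : ℤ → ZMod 3) hdet
  have h4 := congr_arg (Int.cast : ℤ → ZMod 4) hdet
  push_cast at h3 h4
  refine zeta12_zpow_eq ?_ ?_
  · simpa [cast_etaExponent, ModularGroup.coe_T, Matrix.mul_apply, Fin.sum_univ_two] using
      etaExponent_mul_T.1 _ _ _ _ h3
  · simpa [cast_etaExponent, ModularGroup.coe_T, Matrix.mul_apply, Fin.sum_univ_two] using
      etaExponent_mul_T.2 _ _ _ _ h4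

theorem etaMult_mul_S (γ : SL(2, ℤ)) :
    etaMult (γ * ModularGroup.S) = etaMult γ * Complex.I⁻¹ := by
  rw [etaMult, etaMult, ← zeta12_pow_three, ← zpow_neg, ← zpow_add₀ zeta12_ne_zero]
  have hdet := SL_det γ
  have h3 := congr_arg (Int.cast : ℤ → ZMod 3) hdet
  have h4 := congr_arg (Int.cast : ℤ → ZMod 4) hdet
  push_cast at h3 h4
  refine zeta12_zpow_eq ?_ ?_
  · simpa [cast_etaExponent, ModularGroup.coe_S, Matrix.mul_apply, Fin.sum_univ_two,
      sub_eq_add_neg] using etaExponent_mul_S.1 _ _ _ _ h3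
  · simpa [cast_etaExponent, ModularGroup.coe_S, Matrix.mul_apply, Fin.sum_univ_two,
      sub_eq_add_neg] using etaExponent_mul_S.2 _ _ _ _ h4

/-- The square of the Dedekind eta function. -/
noncomputable def etaSq (z : ℍ) : ℂ := ModularForm.eta z ^ 2

theorem etaSq_slash_T : etaSq ∣[(1 : ℤ)] ModularGroup.T = zeta12 • etaSq := by
  funext z
  have h1 : denom (ModularGroup.T : SL(2, ℤ)) z = 1 := by
    rw [denom_SL]; simp [ModularGroup.coe_T]
  rw [ModularForm.SL_slash_apply, h1, modular_T_smul]
  simp only [etaSq, ModularForm.eta, one_zpow, mul_one, Pi.smul_apply, smul_eq_mul, coe_vadd,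
    Complex.ofReal_one]
  have h2 : ∀ n : ℕ, ModularForm.eta_q n (1 + (z : ℂ)) = ModularForm.eta_q n z := fun n ↦ by
    simp only [ModularForm.eta_q]
    rw [add_comm]
    congr 1
    have := Complex.exp_periodic (2 * π * Complex.I * z)
    simp only [Periodic.qParam, Complex.ofReal_one, div_one, mul_add, mul_one, this]
  simp only [h2, mul_pow, ← mul_assoc]
  congr 1
  rw [Periodic.qParam, Periodic.qParam, zeta12, ← Complex.exp_nat_mul, ← Complex.exp_nat_mul,
    ← Complex.exp_add]
  congr 1
  push_cast
  ring

theorem etaSq_slash_S : etaSq ∣[(1 : ℤ)] ModularGroup.S = Complex.I⁻¹ • etaSq := by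
  funext z
  have hsq : ∀ w : ℂ, w ≠ 0 → Complex.sqrt w ^ 2 = w := fun w hw ↦ by
    rw [Complex.sqrt, ← Complex.cpow_nat_mul]
    simp
  rw [ModularForm.SL_slash_apply, ModularGroup.denom_S, modular_S_smul]
  have h := ModularForm.eta_comp_eq_csqrt_I_inv z.2
  simp only [comp_apply, Pi.smul_apply, Pi.mul_apply, smul_eq_mul] at h
  have hz : (z : ℂ) ≠ 0 := z.ne_zero
  have h' : ModularForm.eta (-(z : ℂ))⁻¹ = (Complex.sqrt Complex.I)⁻¹ *
      (Complex.sqrt z * ModularForm.eta z) := by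
    rw [← h]; congr 1; field_simp
  simp only [etaSq, h', mul_pow, inv_pow, hsq _ hz, hsq _ Complex.I_ne_zero,
    Pi.smul_apply, smul_eq_mul, zpow_neg, zpow_one]
  field_simp

/-- Induction on words in `S` and `T`: under right multiplication by a generator the exponent
changes by `+1` for `T` and by `-3` for `S`, matching the factors `ζ₁₂` and `i⁻¹` that `η²`
acquires. -/
theorem etaSq_slash (γ : SL(2, ℤ)) : etaSq ∣[(1 : ℤ)] γ = etaMult γ • etaSq := by
  have hmem : γ ∈ Subgroup.closure {ModularGroup.S, ModularGroup.T} := by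
    simp [SpecialLinearGroup.SL2Z_generators]
  have key : ∀ x ∈ ({ModularGroup.S, ModularGroup.T} : Set SL(2, ℤ)), ∃ c : ℂ, c ≠ 0 ∧
      etaSq ∣[(1 : ℤ)] x = c • etaSq ∧ ∀ y, etaMult (y * x) = etaMult y * c := by
    rintro x (rfl | rfl)
    · exact ⟨_, inv_ne_zero Complex.I_ne_zero, etaSq_slash_S, etaMult_mul_S⟩
    · exact ⟨_, zeta12_ne_zero, etaSq_slash_T, etaMult_mul_T⟩
  induction hmem using Subgroup.closure_induction_right with
  | one => simp [etaMult, etaExponent]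
  | mul_right x hx y hy ih =>
    obtain ⟨c, -, h1, h2⟩ := key y hy
    rw [SlashAction.slash_mul, ih, ModularForm.SL_smul_slash, h1, h2, smul_smul]
  | mul_inv_cancel x hx y hy ih =>
    obtain ⟨c, h0, h1, h2⟩ := key y hy
    have h3 : etaMult (x * y⁻¹) = etaMult x * c⁻¹ := by
      have := h2 (x * y⁻¹)
      rw [inv_mul_cancel_right] at this
      rw [this, mul_assoc, mul_inv_cancel₀ h0, mul_one]
    have h4 : etaSq ∣[(1 : ℤ)] y⁻¹ = c⁻¹ • etaSq := by
      have : etaSq = c⁻¹ • (etaSq ∣[(1 : ℤ)] y) := by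
        rw [h1, smul_smul, inv_mul_cancel₀ h0, one_smul]
      nth_rw 1 [this]
      rw [ModularForm.SL_smul_slash, ← SlashAction.slash_mul, mul_inv_cancel,
        SlashAction.slash_one]
    rw [SlashAction.slash_mul, ih, ModularForm.SL_smul_slash, h4, h3, smul_smul]

/-! ### Eta quotients with even exponents on `Γ₀(42)` -/

theorem mdifferentiable_eta : MDiff (fun z : ℍ ↦ ModularForm.eta z) := by
  rw [UpperHalfPlane.mdifferentiable_iff]
  refine .congr (fun z hz ↦ (ModularForm.differentiableAt_eta_of_mem_upperHalfPlaneSet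
    hz).differentiableWithinAt) fun z hz ↦ ?_
  simp [ofComplex_apply_of_im_pos hz]

/-- The twelfth power is the discriminant, `q` times a product tending to 1, and `|q| = exp (-2π Im
z)`. Twelfth roots may be taken in both directions of the estimate. -/
theorem etaSq_isTheta : etaSq =Θ[atImInfty] fun z ↦ Real.exp (-(π / 6) * z.im) := by
  have h1 : (fun z ↦ etaSq z ^ 12) =Θ[atImInfty] fun z ↦ Real.exp (-(π / 6) * z.im) ^ 12 := by
    have h2 : (fun z ↦ etaSq z ^ 12) = fun z : ℍ ↦ Periodic.qParam 1 (z : ℂ) *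
        ∏' n, (1 - ModularForm.eta_q n z) ^ 24 := funext fun z ↦ by
      rw [← ModularForm.discriminant_eq_q_prod, etaSq, ← pow_mul]; rfl
    have h3 : (fun z : ℍ ↦ ∏' n, (1 - ModularForm.eta_q n z) ^ 24) =Θ[atImInfty]
        fun _ ↦ (1 : ℝ) :=
      ((isEquivalent_const_iff_tendsto one_ne_zero).mpr
        ModularForm.tendsto_atImInfty_tprod_one_sub_eta_q_pow).isTheta.trans
        (isTheta_const_const one_ne_zero one_ne_zero)
    have h4 : (fun z : ℍ ↦ Periodic.qParam 1 (z : ℂ)) =Θ[atImInfty]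
        fun z ↦ Real.exp (-(π / 6) * z.im) ^ 12 := by
      refine IsTheta.of_norm_eventuallyEq_norm (.of_forall fun z ↦ ?_)
      simp only [Periodic.norm_qParam, ← Real.exp_nat_mul, Real.norm_eq_abs, Real.abs_exp]
      congr 1
      push_cast
      simp
      ring
    rw [h2]
    simpa using h4.mul h3
  exact ⟨h1.1.of_pow (by norm_num), h1.2.of_pow (by norm_num)⟩

theorem etaAt_sq (δ : ℕ) [NeZero δ] (z : ℍ) : etaAt δ z ^ 2 = etaSq (scale δ z) := rfl

theorem etaAt_ne_zero {δ : ℕ} (hδ : 0 < δ) (z : ℍ) : etaAt δ z ≠ 0 := by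
  have : NeZero δ := ⟨hδ.ne'⟩
  exact ModularForm.eta_ne_zero (scale δ z).2

theorem mdifferentiable_etaAt {δ : ℕ} (hδ : 0 < δ) : MDiff (etaAt δ) := by
  have : NeZero δ := ⟨hδ.ne'⟩
  exact mdifferentiable_scale δ mdifferentiable_eta

/-- The positive divisors of `42`. -/
def divisors42 : Finset ℕ := {1, 2, 3, 6, 7, 14, 21, 42}

theorem pos_of_mem_divisors42 {δ : ℕ} (h : δ ∈ divisors42) : 0 < δ := by
  simp only [divisors42, Finset.mem_insert, Finset.mem_singleton] at h
  omega

theorem div_mul_of_mem_divisors42 {δ : ℕ} (h : δ ∈ divisors42) : δ * (42 / δ) = 42 := by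
  revert δ; decide

theorem etaAt_sq_smul {δ : ℕ} (hδ : δ ∈ divisors42) {γ : SL(2, ℤ)} {c : ℤ} (hc : γ 1 0 = 42 * c)
    (z : ℍ) : etaAt δ (γ • z) ^ 2 =
      zeta12 ^ etaExponent (γ 0 0) (δ * γ 0 1) ((42 / δ : ℕ) * c) (γ 1 1) *
        (denom γ z * etaAt δ z ^ 2) := by
  have : NeZero δ := ⟨(pos_of_mem_divisors42 hδ).ne'⟩
  have h42 : (δ : ℤ) * (42 / δ : ℕ) = 42 := by exact_mod_cast div_mul_of_mem_divisors42 hδ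
  have hc' : γ 1 0 = δ * ((42 / δ : ℕ) * c) := by rw [hc, ← mul_assoc, h42]
  obtain ⟨γ', h00, h01, h10, h11⟩ := exists_conj δ (hc' ▸ dvd_mul_right _ _ : (δ : ℤ) ∣ γ 1 0)
  have h10' : γ' 1 0 = (42 / δ : ℕ) * c :=
    mul_left_cancel₀ (by exact_mod_cast NeZero.ne δ : (δ : ℤ) ≠ 0) (h10.trans hc')
  obtain ⟨h1, h2⟩ := scale_smul_of_dvd δ h00 h01 h10 h11 z
  have h3 := congrFun (etaSq_slash γ') (scale δ z)
  rw [ModularForm.SL_slash_apply, h2, ← h1, zpow_neg, zpow_one, Pi.smul_apply, smul_eq_mul,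
    ← div_eq_mul_inv, div_eq_iff (denom_ne_zero _ z), etaMult, h00, h01, h10', h11] at h3
  rw [etaAt_sq, etaAt_sq, h3]
  ring

/-- In the decomposition of `exists_scale_smul` the affine map multiplies the imaginary part by `A /
D = A² / δ`, with `A = gcd(δ, c)`. -/
theorem etaAt_sq_smul_isTheta {δ : ℕ} (hδ : 0 < δ) (γ : SL(2, ℤ)) :
    (fun z : ℍ ↦ etaAt δ (γ • z) ^ 2 * (denom γ z)⁻¹) =Θ[atImInfty]
      fun z ↦ Real.exp (-(π / 6) * ((Nat.gcd δ (γ 1 0).natAbs : ℝ) ^ 2 / δ) * z.im) := by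
  have : NeZero δ := ⟨hδ.ne'⟩
  obtain ⟨A, D, B, _, _, γ', hA, hAD, h⟩ := exists_scale_smul δ γ
  have hD : (D : ℝ) ≠ 0 := by exact_mod_cast NeZero.ne D
  have hA0 : (A : ℝ) ≠ 0 := by exact_mod_cast NeZero.ne A
  have h1 : (fun z : ℍ ↦ etaAt δ (γ • z) ^ 2 * (denom γ z)⁻¹) = fun z ↦
      ((D : ℂ) ^ (-1 : ℤ) * etaMult γ') * etaSq (affineMap A D B z) := funext fun z ↦ by
    have h2 := slash_scale_apply δ 1 etaSq (h z).1 (h z).2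
    rw [ModularForm.SL_slash_apply, etaSq_slash, zpow_neg, zpow_one] at h2
    rw [etaAt_sq, h2, Pi.smul_apply, smul_eq_mul]
    ring
  rw [h1, isTheta_const_mul_left (mul_ne_zero (zpow_ne_zero _ (by exact_mod_cast hD))
    (etaMult_ne_zero _))]
  have h3 : (etaSq ∘ affineMap A D B) =Θ[atImInfty] _ :=
    ⟨etaSq_isTheta.1.comp_tendsto (tendsto_affineMap A D B),
      etaSq_isTheta.2.comp_tendsto (tendsto_affineMap A D B)⟩
  refine h3.trans_eventuallyEq (.of_forall fun z ↦ ?_)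
  have hAD' : (δ : ℝ) = A * D := by rw [← hAD]; push_cast; rfl
  simp only [comp_apply, im_affineMap, ← hA, hAD']
  congr 1
  field_simp

/-- `∏_δ η(δz) ^ (2 s δ)`, the product being over the divisors of `42`. -/
noncomputable def etaQuot (s : ℕ → ℤ) (z : ℍ) : ℂ := ∏ δ ∈ divisors42, (etaAt δ z ^ 2) ^ s δ

/-- The multiplier of `etaQuot s` is trivial on `Γ₀(42)`. -/
def TrivialMult (s : ℕ → ℤ) : Prop :=
  (∀ a b c d : ZMod 3, a * d - b * (42 * c) = 1 → ∑ δ ∈ divisors42,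
    etaExponent a (δ * b) ((42 / δ : ℕ) * c) d * (s δ : ZMod 3) = 0) ∧
  (∀ a b c d : ZMod 4, a * d - b * (42 * c) = 1 → ∑ δ ∈ divisors42,
    etaExponent a (δ * b) ((42 / δ : ℕ) * c) d * (s δ : ZMod 4) = 0)

instance (s : ℕ → ℤ) : Decidable (TrivialMult s) := by unfold TrivialMult; infer_instance

/-- `etaQuot s` has nonnegative order at every cusp. -/
def NonnegOrder (s : ℕ → ℤ) : Prop :=
  ∀ g ∈ divisors42, 0 ≤ ∑ δ ∈ divisors42, s δ * (42 / δ : ℕ) * (Nat.gcd δ g : ℤ) ^ 2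

instance (s : ℕ → ℤ) : Decidable (NonnegOrder s) := by unfold NonnegOrder; infer_instance

theorem mdifferentiable_zpow {f : ℍ → ℂ} (hf : MDiff f) (h0 : ∀ z, f z ≠ 0) (n : ℤ) :
    MDiff (fun z ↦ f z ^ n) := by
  rw [UpperHalfPlane.mdifferentiable_iff] at hf ⊢
  exact hf.zpow (.inl fun z _ ↦ h0 _)

theorem mdifferentiable_etaQuot (s : ℕ → ℤ) : MDiff (etaQuot s) := by
  have h : etaQuot s = ∏ δ ∈ divisors42, fun z ↦ (etaAt δ z ^ 2) ^ s δ := by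
    funext z; simp [etaQuot]
  rw [h]
  refine MDifferentiable.prod fun δ hδ ↦ ?_
  have hp := pos_of_mem_divisors42 hδ
  exact mdifferentiable_zpow ((mdifferentiable_etaAt hp).pow 2)
    (fun z ↦ pow_ne_zero _ (etaAt_ne_zero hp z)) _

theorem prod_zpow_eq_zpow_sum {ι : Type*} (t : Finset ι) {x : ℂ} (hx : x ≠ 0) (n : ι → ℤ) :
    ∏ i ∈ t, x ^ n i = x ^ ∑ i ∈ t, n i := by
  classical
  induction t using Finset.induction_on with
  | empty => simp
  | insert a t ha ih => rw [Finset.prod_insert ha, Finset.sum_insert ha, zpow_add₀ hx, ih]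

theorem etaQuot_slash {s : ℕ → ℤ} {k : ℤ} (hk : ∑ δ ∈ divisors42, s δ = k) (hs : TrivialMult s)
    {γ : SL(2, ℤ)} (hγ : γ ∈ CongruenceSubgroup.Gamma0 42) : etaQuot s ∣[k] γ = etaQuot s := by
  rw [CongruenceSubgroup.Gamma0_mem, ZMod.intCast_zmod_eq_zero_iff_dvd] at hγ
  obtain ⟨c, hc⟩ := hγ
  push_cast at hc
  funext z
  have hdet := SL_det γ
  rw [hc] at hdet
  have h3 := congr_arg (Int.cast : ℤ → ZMod 3) hdet
  have h4 := congr_arg (Int.cast : ℤ → ZMod 4) hdet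
  push_cast at h3 h4
  have hd : denom γ z ≠ 0 := denom_ne_zero _ z
  have h1 : etaQuot s (γ • z) = zeta12 ^ (∑ δ ∈ divisors42,
      etaExponent (γ 0 0) (δ * γ 0 1) ((42 / δ : ℕ) * c) (γ 1 1) * s δ) *
        (denom γ z ^ k * etaQuot s z) := by
    rw [← hk, ← prod_zpow_eq_zpow_sum _ zeta12_ne_zero, ← prod_zpow_eq_zpow_sum _ hd, etaQuot,
      etaQuot, ← Finset.prod_mul_distrib, ← Finset.prod_mul_distrib]
    refine Finset.prod_congr rfl fun δ hδ ↦ ?_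
    rw [etaAt_sq_smul hδ hc, mul_zpow, mul_zpow, zpow_mul]
  have h2 : zeta12 ^ (∑ δ ∈ divisors42,
      etaExponent (γ 0 0) (δ * γ 0 1) ((42 / δ : ℕ) * c) (γ 1 1) * s δ) = zeta12 ^ (0 : ℤ) := by
    refine zeta12_zpow_eq ?_ ?_
    · simp only [Int.cast_sum, Int.cast_mul, cast_etaExponent, Int.cast_natCast, Int.cast_zero]
      exact hs.1 _ _ _ _ h3
    · simp only [Int.cast_sum, Int.cast_mul, cast_etaExponent, Int.cast_natCast, Int.cast_zero]
      exact hs.2 _ _ _ _ h4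
  rw [ModularForm.SL_slash_apply, h1, h2, zpow_neg]
  field_simp

theorem exists_gcd_eq (c : ℤ) : ∃ g ∈ divisors42, ∀ δ ∈ divisors42,
    Nat.gcd δ c.natAbs = Nat.gcd δ g := by
  refine ⟨Nat.gcd 42 c.natAbs, ?_, fun δ hδ ↦ ?_⟩
  · have : Nat.gcd 42 c.natAbs ∈ Nat.divisors 42 := by simp [Nat.gcd_dvd_left]
    rwa [show Nat.divisors 42 = divisors42 by decide] at this
  · rw [← Nat.gcd_assoc, Nat.gcd_eq_left (n := 42) ⟨_, (div_mul_of_mem_divisors42 hδ).symm⟩]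

/-- The growth rates of the factors add up to `-(π Im z / 252)` times the sum in `NonnegOrder`. They
depend on the lower left entry `c` only through `gcd(42, c)`, so the divisors of 42 account for all
cusps. -/
theorem etaQuot_bdd {s : ℕ → ℤ} {k : ℤ} (hk : ∑ δ ∈ divisors42, s δ = k) (hs : NonnegOrder s)
    (γ : SL(2, ℤ)) : IsBoundedAtImInfty (etaQuot s ∣[k] γ) := by
  have h1 : (etaQuot s ∣[k] γ) = fun z ↦ ∏ δ ∈ divisors42,
      (etaAt δ (γ • z) ^ 2 * (denom γ z)⁻¹) ^ s δ := funext fun z ↦ by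
    have hd : denom γ z ≠ 0 := denom_ne_zero _ z
    rw [ModularForm.SL_slash_apply, ← hk, zpow_neg, ← inv_zpow,
      ← prod_zpow_eq_zpow_sum _ (inv_ne_zero hd), etaQuot, ← Finset.prod_mul_distrib]
    exact Finset.prod_congr rfl fun δ hδ ↦ (mul_zpow _ _ _).symm
  obtain ⟨g, hg, hgcd⟩ := exists_gcd_eq (γ 1 0)
  have h2 : (etaQuot s ∣[k] γ) =O[atImInfty] fun z ↦ ∏ δ ∈ divisors42,
      Real.exp (-(π / 6) * ((Nat.gcd δ (γ 1 0).natAbs : ℝ) ^ 2 / δ) * z.im) ^ s δ := by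
    rw [h1]
    exact IsBigO.finsetProd fun δ hδ ↦
      ((etaAt_sq_smul_isTheta (pos_of_mem_divisors42 hδ) γ).zpow (s δ)).1
  refine h2.trans (.of_bound 1 (.of_forall fun z ↦ ?_))
  have h3 : ∀ δ ∈ divisors42,
      Real.exp (-(π / 6) * ((Nat.gcd δ (γ 1 0).natAbs : ℝ) ^ 2 / δ) * z.im) ^ s δ =
      Real.exp (-(π / 6 * z.im / 42) * ((s δ * (42 / δ : ℕ) * (Nat.gcd δ g : ℤ) ^ 2 : ℤ) : ℝ)) := by
    intro δ hδ
    rw [← Real.rpow_intCast, ← Real.exp_mul, hgcd δ hδ]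
    congr 1
    have h42 : (δ : ℝ) * (42 / δ : ℕ) = 42 := by exact_mod_cast div_mul_of_mem_divisors42 hδ
    have hδ0 : (δ : ℝ) ≠ 0 := by exact_mod_cast (pos_of_mem_divisors42 hδ).ne'
    have : ((42 / δ : ℕ) : ℝ) = 42 / δ := by rw [eq_div_iff hδ0, mul_comm, h42]
    simp only [Int.cast_mul, Int.cast_pow, Int.cast_natCast, this]
    field_simp
  rw [Finset.prod_congr rfl h3, ← Real.exp_sum, ← Finset.mul_sum, ← Int.cast_sum]
  simp only [Real.norm_eq_abs, Real.abs_exp, Pi.one_apply, norm_one, mul_one]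
  refine Real.exp_le_one_iff.mpr ?_
  have h4 : (0 : ℝ) ≤ ((∑ δ ∈ divisors42, s δ * (42 / δ : ℕ) * (Nat.gcd δ g : ℤ) ^ 2 : ℤ) : ℝ) :=
    by exact_mod_cast hs g hg
  have h5 : 0 ≤ π / 6 * z.im / 42 := by have := z.im_pos; positivity
  nlinarith

theorem isModForm_etaQuot {s : ℕ → ℤ} {k : ℤ} (hk : ∑ δ ∈ divisors42, s δ = k)
    (hs : TrivialMult s) (hs' : NonnegOrder s) :
    IsModForm (CongruenceSubgroup.Gamma0 42) k (etaQuot s) :=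
  ⟨mdifferentiable_etaQuot s, fun _ hγ ↦ etaQuot_slash hk hs hγ, etaQuot_bdd hk hs'⟩

/-! ### The Sturm bound -/

/-- The modular form attached to a function with the property `IsModForm`. -/
def IsModForm.toModularForm {Γ : Subgroup SL(2, ℤ)} [Γ.FiniteIndex] {k : ℤ} {f : ℍ → ℂ}
    (hf : IsModForm Γ k f) : ModularForm (Γ : Subgroup (GL (Fin 2) ℝ)) k where
  toFun := f
  slash_action_eq' := by
    rintro _ ⟨γ, hγ, rfl⟩
    exact hf.slash γ hγ
  holo' := hf.holo
  bdd_at_cusps' {c} hc := by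
    rw [Subgroup.IsArithmetic.isCusp_iff_isCusp_SL2Z] at hc
    rw [OnePoint.isBoundedAt_iff_forall_SL2Z hc]
    exact fun γ _ ↦ hf.bdd γ

@[simp] theorem IsModForm.coe_toModularForm {Γ : Subgroup SL(2, ℤ)} [Γ.FiniteIndex] {k : ℤ}
    {f : ℍ → ℂ} (hf : IsModForm Γ k f) : ⇑hf.toModularForm = f := rfl

theorem IsModForm.hasQExp {Γ : Subgroup SL(2, ℤ)} [Γ.FiniteIndex] (hT : ModularGroup.T ∈ Γ)
    {k : ℤ} {f : ℍ → ℂ} (hf : IsModForm Γ k f) : HasQExp f (qExpansion 1 f) := by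
  intro τ
  have h1 : (1 : ℝ) ∈ (Γ : Subgroup (GL (Fin 2) ℝ)).strictPeriods := by
    rw [Subgroup.strictPeriods_eq_zmultiples_one_of_T_mem hT]
    exact AddSubgroup.mem_zmultiples 1
  exact ModularForm.hasSum_qExpansion (Γ := (Γ : Subgroup (GL (Fin 2) ℝ))) hf.toModularForm
    one_pos h1 τ

theorem card_quotient_eq_index (Γ : Subgroup SL(2, ℤ)) :
    Nat.card (𝒮ℒ ⧸ (Γ : Subgroup (GL (Fin 2) ℝ)).subgroupOf 𝒮ℒ) = Γ.index := by
  change (Γ.map (Matrix.SpecialLinearGroup.mapGL ℝ)).relIndex _ = _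
  rw [MonoidHom.range_eq_map, Subgroup.relIndex_map_map_of_injective _ _
    Matrix.SpecialLinearGroup.mapGL_injective, Subgroup.relIndex_top_right]

/-- The Sturm bound for a subgroup of `SL(2, ℤ)` containing `T`. -/
theorem IsModForm.eq_zero_of_isBigO {Γ : Subgroup SL(2, ℤ)} [Γ.FiniteIndex] {k N : ℕ} {f : ℍ → ℂ}
    (hf : IsModForm Γ k f) (hN : k * Γ.index / 12 < N)
    (h : f =O[atImInfty] fun τ ↦ Periodic.qParam 1 (τ : ℂ) ^ N) : f = 0 := by
  classical
  set F := hf.toModularForm with hF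
  -- The norm is the product of the translates of `f` over the cosets, a form of level one and
  -- weight `k` times the index. The identity coset contributes `f = O(q^N)` and the other factors
  -- are bounded, so `G = O(q^N)` and the level one bound applies.
  set G := ModularForm.norm 𝒮ℒ F with hG
  have hGq : HasQExp G (qExpansion 1 G) := fun τ ↦
    ModularForm.hasSum_qExpansion G one_pos one_mem_strictPeriods_SL τ
  have hGO : G =O[atImInfty] fun τ ↦ Periodic.qParam 1 (τ : ℂ) ^ N := by
    let _ := Fintype.ofFinite (𝒮ℒ ⧸ (Γ : Subgroup (GL (Fin 2) ℝ)).subgroupOf 𝒮ℒ)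
    have h1 : (G : ℍ → ℂ) = fun τ ↦
        ∏ q : 𝒮ℒ ⧸ (Γ : Subgroup (GL (Fin 2) ℝ)).subgroupOf 𝒮ℒ,
          SlashInvariantForm.quotientFunc F q τ := by
      rw [hG, ModularForm.coe_norm]
      funext τ
      simp only [Finset.prod_apply]
    have h2 : ∀ q : 𝒮ℒ ⧸ (Γ : Subgroup (GL (Fin 2) ℝ)).subgroupOf 𝒮ℒ,
        (fun τ ↦ SlashInvariantForm.quotientFunc F q τ) =O[atImInfty] fun _ ↦ (1 : ℝ) := by
      refine Quotient.forall.mpr ?_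
      rintro ⟨_, γ, rfl⟩
      have := hf.bdd γ⁻¹
      have hi : f ∣[(k : ℤ)] γ⁻¹ = f ∣[(k : ℤ)] (Matrix.SpecialLinearGroup.mapGL ℝ γ)⁻¹ := by
        rw [← map_inv]; rfl
      rw [hi] at this
      exact this
    have h3 : (fun τ ↦ SlashInvariantForm.quotientFunc F
        (⟦1⟧ : 𝒮ℒ ⧸ (Γ : Subgroup (GL (Fin 2) ℝ)).subgroupOf 𝒮ℒ) τ) = f := by
      rw [SlashInvariantForm.quotientFunc_mk]
      simp [hF]
    rw [h1]
    have h4 : (fun τ ↦ ∏ q : 𝒮ℒ ⧸ (Γ : Subgroup (GL (Fin 2) ℝ)).subgroupOf 𝒮ℒ,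
          SlashInvariantForm.quotientFunc F q τ) = fun τ ↦
        f τ * ∏ q ∈ Finset.univ.erase
          (⟦1⟧ : 𝒮ℒ ⧸ (Γ : Subgroup (GL (Fin 2) ℝ)).subgroupOf 𝒮ℒ),
            SlashInvariantForm.quotientFunc F q τ := by
      funext τ
      refine (Finset.mul_prod_erase Finset.univ (fun q ↦ SlashInvariantForm.quotientFunc F q τ)
        (Finset.mem_univ (⟦1⟧ : 𝒮ℒ ⧸ (Γ : Subgroup (GL (Fin 2) ℝ)).subgroupOf 𝒮ℒ))).symm.trans ?_
      rw [← congrFun h3 τ]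
      congr!
    rw [h4]
    have h5 := h.norm_right.mul (IsBigO.finsetProd (s := Finset.univ.erase
      (⟦1⟧ : 𝒮ℒ ⧸ (Γ : Subgroup (GL (Fin 2) ℝ)).subgroupOf 𝒮ℒ)) fun q _ ↦ h2 q)
    simp only [Finset.prod_const_one, mul_one] at h5
    exact h5.of_norm_right
  have hcoeff := hGq.coeff_eq_zero_of_isBigO hGO
  have hG0 : G = 0 := by
    apply ModularForm.sturm_bound_levelOne
    refine lt_of_lt_of_le ?_ (PowerSeries.nat_le_order _ N hcoeff)
    have : ((k : ℤ) * (Nat.card (𝒮ℒ ⧸ (Γ : Subgroup (GL (Fin 2) ℝ)).subgroupOf 𝒮ℒ) : ℕ)).toNat =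
        k * Γ.index := by rw [card_quotient_eq_index]; norm_cast
    rw [this]
    exact_mod_cast hN
  simpa [hF] using (ModularForm.norm_eq_zero_iff 𝒮ℒ F).mp hG0

/-! ### Stabilizers up to sign, and the index of `Γ₀(42)` -/

/-- The subgroup of `SL(2, ℤ)` fixing `f` in weight `k`. -/
def slashStabilizer (k : ℤ) (f : ℍ → ℂ) : Subgroup SL(2, ℤ) where
  carrier := {γ | f ∣[k] γ = f}
  mul_mem' {a b} ha hb := by
    simp only [Set.mem_ofPred_eq] at *
    rw [SlashAction.slash_mul, ha, hb]
  one_mem' := SlashAction.slash_one _ _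
  inv_mem' {a} ha := by
    simp only [Set.mem_ofPred_eq] at *
    nth_rw 1 [← ha]
    rw [← SlashAction.slash_mul, mul_inv_cancel, SlashAction.slash_one]

theorem mem_slashStabilizer {k : ℤ} {f : ℍ → ℂ} {γ : SL(2, ℤ)} :
    γ ∈ slashStabilizer k f ↔ f ∣[k] γ = f := Iff.rfl

theorem index_ne_zero_and_le_two {G : Type*} [Group G] {K : Subgroup G}
    (hK : ∀ a b, a ∉ K → b ∉ K → a⁻¹ * b ∈ K) : K.index ≠ 0 ∧ K.index ≤ 2 := by
  classical
  have hwd : ∀ a b : G, QuotientGroup.leftRel K a b → decide (a ∈ K) = decide (b ∈ K) := by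
    intro a b hab
    rw [QuotientGroup.leftRel_apply] at hab
    simp only [decide_eq_decide]
    exact ⟨fun h ↦ by simpa using mul_mem h hab, fun h ↦ by simpa using mul_mem h (inv_mem hab)⟩
  have hinj : Injective
      fun q : G ⧸ K ↦ Quotient.lift (fun a ↦ decide (a ∈ K)) hwd q := by
    refine Quotient.ind₂ fun a b hab ↦ ?_
    simp only [Quotient.lift_mk, decide_eq_decide] at hab
    rw [Quotient.eq, QuotientGroup.leftRel_apply]
    by_cases ha : a ∈ K
    · exact mul_mem (inv_mem ha) (hab.mp ha)
    · exact hK a b ha fun hb ↦ ha (hab.mpr hb)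
  have : Finite (G ⧸ K) := Finite.of_injective _ hinj
  exact ⟨Nat.card_pos.ne', by simpa [Subgroup.index] using Nat.card_le_card_of_injective _ hinj⟩

/-- Two elements that both send `f` to `-f` differ by one that fixes `f`, so there is at most one
nontrivial coset. -/
theorem relIndex_slashStabilizer {k : ℤ} {f : ℍ → ℂ} {Γ : Subgroup SL(2, ℤ)}
    (hf : ∀ γ ∈ Γ, f ∣[k] γ = f ∨ f ∣[k] γ = -f) :
    (slashStabilizer k f).relIndex Γ ≠ 0 ∧ (slashStabilizer k f).relIndex Γ ≤ 2 := by
  refine index_ne_zero_and_le_two fun a b ha hb ↦ ?_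
  rw [Subgroup.mem_subgroupOf, mem_slashStabilizer] at *
  have ha' := (hf a a.2).resolve_left ha
  have hb' := (hf b b.2).resolve_left hb
  have hai : f ∣[k] (a : SL(2, ℤ))⁻¹ = -f := by
    have : f = -(f ∣[k] (a : SL(2, ℤ))) := by rw [ha', neg_neg]
    nth_rw 1 [this]
    rw [SlashAction.neg_slash, ← SlashAction.slash_mul, mul_inv_cancel, SlashAction.slash_one]
  rw [Subgroup.coe_mul, Subgroup.coe_inv, SlashAction.slash_mul, hai, SlashAction.neg_slash, hb',
    neg_neg]

/-- The point of `ℙ¹(𝔽_p)` with homogeneous coordinates `(a, c)`. -/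
def projCode (p : ℕ) [Fact p.Prime] (a c : ℤ) : Option (ZMod p) :=
  if (c : ZMod p) = 0 then none else some ((a : ZMod p) * (c : ZMod p)⁻¹)

theorem projCode_eq {p : ℕ} [Fact p.Prime] {a c a' c' : ℤ}
    (h : projCode p a c = projCode p a' c') : (p : ℤ) ∣ a * c' - c * a' := by
  rw [← ZMod.intCast_zmod_eq_zero_iff_dvd]
  push_cast
  unfold projCode at h
  split_ifs at h with h1 h2 h2
  · simp [h1, h2]
  · rw [Option.some.injEq, ← div_eq_mul_inv, ← div_eq_mul_inv, div_eq_div_iff h1 h2] at h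
    rw [h]; ring

instance fact_prime_seven : Fact (Nat.Prime 7) := ⟨by norm_num⟩

/-- A left coset of `Γ₀(42)` is determined by the first column of a representative as a point of
`ℙ¹` over `𝔽₂`, `𝔽₃` and `𝔽₇`, which leaves `3 · 4 · 8` possibilities. An upper bound is all the
Sturm argument needs. -/
theorem index_Gamma0_42_le : (CongruenceSubgroup.Gamma0 42).index ≤ 96 := by
  let code (γ : SL(2, ℤ)) : Option (ZMod 2) × Option (ZMod 3) × Option (ZMod 7) :=
    (projCode 2 (γ 0 0) (γ 1 0), projCode 3 (γ 0 0) (γ 1 0), projCode 7 (γ 0 0) (γ 1 0))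
  have h := Nat.card_le_card_of_injective
    (fun q : SL(2, ℤ) ⧸ CongruenceSubgroup.Gamma0 42 ↦ code q.out) (by
      intro x y hxy
      simp only [code, Prod.mk.injEq] at hxy
      have h2 := projCode_eq hxy.1
      have h3 := projCode_eq hxy.2.1
      have h7 := projCode_eq hxy.2.2
      rw [← Quotient.out_equiv_out, ← Quotient.eq_iff_equiv, Quotient.eq,
        QuotientGroup.leftRel_apply, CongruenceSubgroup.Gamma0_mem,
        ZMod.intCast_zmod_eq_zero_iff_dvd]
      -- The lower left entry of `x⁻¹y` is the determinant of the two first columns, which vanishes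
      -- modulo `p` when the columns are proportional.
      have h1 : ((x.out)⁻¹ * y.out) 1 0 =
          x.out 0 0 * y.out 1 0 - x.out 1 0 * y.out 0 0 := by
        rw [Matrix.SpecialLinearGroup.coe_mul, Matrix.mul_apply, Fin.sum_univ_two,
          Matrix.SpecialLinearGroup.SL2_inv_expl]
        simp
        ring
      rw [h1]
      push_cast at *
      omega)
  simpa [Subgroup.index] using h

/-! ### The pentagonal number theorem and expansions of eta products -/

theorem norm_coeff_pentagonalSeries_le (n : ℕ) :
    ‖(PowerSeries.pentagonalSeries ℂ).coeff n‖ ≤ 1 := by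
  by_cases h : n ∈ Set.range pentagonal
  · obtain ⟨k, rfl⟩ := h
    rw [PowerSeries.coeff_pentagonalSeries_pentagonal]
    rcases Int.units_eq_one_or (Int.negOnePow k) with h | h <;> simp [h]
  · simp [PowerSeries.coeff_pentagonalSeries_eq_zero ℂ h]

theorem summable_pentagonalSeries {q : ℂ} (hq : ‖q‖ < 1) :
    Summable fun n ↦ (PowerSeries.pentagonalSeries ℂ).coeff n * q ^ n := by
  refine .of_norm_bounded (summable_geometric_of_lt_one (norm_nonneg _) hq) fun n ↦ ?_
  rw [norm_mul, norm_pow]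
  exact mul_le_of_le_one_left (by positivity) (norm_coeff_pentagonalSeries_le n)

theorem hasSum_pow_pentagonal {q : ℂ} (hq : ‖q‖ < 1) :
    HasSum (fun k : ℕ ↦ (-1) ^ k * (q ^ pentagonal (-k) - q ^ pentagonal (k + 1)))
      (∑' n, (PowerSeries.pentagonalSeries ℂ).coeff n * q ^ n) := by
  have h := (summable_pentagonalSeries hq).hasSum
  rw [← pentagonal_injective.hasSum_iff fun n hn ↦ by
    simp [PowerSeries.coeff_pentagonalSeries_eq_zero ℂ hn],
    -- The sum over `ℤ` is reflected so that, after folding, the index `k` pairs the exponents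
    -- `pentagonal (-k)` and `pentagonal (k + 1)`.
    ← neg_injective.hasSum_iff (fun x hx ↦ by absurd hx; use -x; simp)] at h
  convert h.nat_add_neg_add_one using 2 with k
  simp_rw [Function.comp_apply, neg_neg, PowerSeries.coeff_pentagonalSeries_pentagonal]
  simp [Int.negOnePow_add]
  ring

theorem norm_prod_one_sub_pow_le {q : ℂ} (hq : ‖q‖ < 1) (k n : ℕ) :
    ‖∏ i ∈ Finset.range n, (1 - q ^ (k + i + 1))‖ ≤ Real.exp (1 - ‖q‖)⁻¹ := by
  have h1 := Finset.norm_prod_one_add_sub_one_le (Finset.range n) fun i ↦ -q ^ (k + i + 1)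
  have h2 : ∑ i ∈ Finset.range n, ‖-q ^ (k + i + 1)‖ ≤ (1 - ‖q‖)⁻¹ := by
    rw [← tsum_geometric_of_lt_one (norm_nonneg _) hq]
    refine (Finset.sum_le_sum fun i _ ↦ ?_).trans
      ((summable_geometric_of_lt_one (norm_nonneg _) hq).sum_le_tsum _ fun i _ ↦ by positivity)
    rw [norm_neg, norm_pow]
    exact pow_le_pow_of_le_one (norm_nonneg _) hq.le (by omega)
  have h3 := norm_le_norm_sub_add (∏ i ∈ Finset.range n, (1 + -q ^ (k + i + 1))) 1
  have h4 := Real.exp_le_exp.mpr h2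
  simp only [norm_one, ← sub_eq_add_neg] at h1 h3
  linarith

/-- Euler's pentagonal number theorem as an identity of functions on the unit disc. -/
theorem tprod_one_sub_pow_eq {q : ℂ} (hq : ‖q‖ < 1) :
    ∏' n, (1 - q ^ (n + 1)) = ∑' n, (PowerSeries.pentagonalSeries ℂ).coeff n * q ^ n := by
  rw [← (hasSum_pow_pentagonal hq).tsum_eq]
  -- This bounds all partial products of the factors `1 - q^j` uniformly, so the remainder series
  -- are dominated by `C` times a geometric series.
  set C := Real.exp (1 - ‖q‖)⁻¹
  have hb (k n : ℕ) : ‖q ^ ((k + 1) * n) * ∏ i ∈ Finset.range (n + 1), (1 - q ^ (k + i + 1))‖ ≤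
      ‖q‖ ^ n * C := by
    rw [norm_mul, norm_pow]
    exact mul_le_mul (pow_le_pow_of_le_one (norm_nonneg _) hq.le (by nlinarith))
      (norm_prod_one_sub_pow_le hq k _) (norm_nonneg _) (by positivity)
  have hg := (summable_geometric_of_lt_one (norm_nonneg _) hq).mul_right C
  refine Pentagonal.tprod_one_sub_pow ?_ (fun k ↦ .of_norm_bounded hg (hb k)) (fun k ↦ ?_)
    (hasSum_pow_pentagonal hq).summable ?_
  · exact tendsto_pow_atTop_nhds_zero_of_norm_lt_one hq
  · simp only [sub_eq_add_neg]
    apply multipliable_one_add_of_summable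
    simp only [norm_neg, norm_pow, add_assoc]
    exact (summable_nat_add_iff _).mpr (summable_geometric_of_lt_one (norm_nonneg _) hq)
  · have hlim := (tendsto_pow_atTop_nhds_zero_of_lt_one (norm_nonneg _) hq).mul_const
      (∑' n, ‖q‖ ^ n * C)
    rw [zero_mul] at hlim
    refine squeeze_zero_norm (fun k ↦ ?_) hlim
    rw [norm_mul, norm_mul, norm_pow, norm_neg, norm_one, one_pow, one_mul, norm_pow]
    refine mul_le_mul (pow_le_pow_of_le_one (norm_nonneg _) hq.le ?_)
      (tsum_of_norm_bounded hg.hasSum (hb k)) (norm_nonneg _) (by positivity)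
    rw [Nat.le_div_iff_mul_le (by simp)]
    nlinarith

/-- The power series `p(X ^ t)`. -/
noncomputable def dilate (t : ℕ) (p : PowerSeries ℂ) : PowerSeries ℂ :=
  .mk fun n ↦ atQuot (fun m ↦ p.coeff m) n t

theorem qParam_natMul (t : ℕ) (z : ℂ) : Periodic.qParam 1 (t * z) = Periodic.qParam 1 z ^ t := by
  simp only [Periodic.qParam, ← Complex.exp_nat_mul]
  congr 1; push_cast; ring

theorem HasQExp.scale {f : ℍ → ℂ} {p : PowerSeries ℂ} (hf : HasQExp f p) (t : ℕ) [NeZero t] :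
    HasQExp (fun z ↦ f (scale t z)) (dilate t p) := by
  intro τ
  have h := hf (Level42.scale t τ)
  have hinj : Injective fun m : ℕ ↦ t * m := fun a b hab ↦
    Nat.eq_of_mul_eq_mul_left (NeZero.pos t) hab
  rw [← hinj.hasSum_iff]
  · convert! h using 2 with m
    simp [dilate, atQuot, NeZero.pos t, qParam_natMul, pow_mul]
  · intro n hn
    have : ¬ t ∣ n := fun ⟨m, hm⟩ ↦ hn ⟨m, hm.symm⟩
    simp [dilate, atQuot, this]

/-- The Euler product `∏ₙ (1 - q ^ n)`. -/
noncomputable def eulerProd (z : ℍ) : ℂ := ∏' n, (1 - Periodic.qParam 1 (z : ℂ) ^ (n + 1))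

theorem hasQExp_eulerProd : HasQExp eulerProd (PowerSeries.pentagonalSeries ℂ) := fun τ ↦ by
  rw [eulerProd, tprod_one_sub_pow_eq (norm_qParam_lt_one τ)]
  exact (summable_pentagonalSeries (norm_qParam_lt_one τ)).hasSum

/-- Separating the factor `q^(δ/24)` lets all fractional powers combine: in each product used here
the total exponent of `exp (2πiz/24)` is a multiple of 24. -/
theorem etaAt_eq (δ : ℕ) [NeZero δ] (z : ℍ) :
    etaAt δ z = Periodic.qParam 24 (z : ℂ) ^ δ * eulerProd (scale δ z) := by
  rw [etaAt, ModularForm.eta, eulerProd, coe_scale]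
  congr 1
  simp only [Periodic.qParam, ← Complex.exp_nat_mul]
  congr 1; push_cast; ring

theorem qParam_24_pow (z : ℂ) : Periodic.qParam 24 z ^ 24 = Periodic.qParam 1 z := by
  simp only [Periodic.qParam, ← Complex.exp_nat_mul]
  congr 1; push_cast; ring

theorem eulerProd_ne_zero (z : ℍ) : eulerProd z ≠ 0 := ModularForm.eta_tprod_ne_zero z.2

theorem HasQExp.apply_eq_of_eq_add_int {f : ℍ → ℂ} {p : PowerSeries ℂ} (hf : HasQExp f p)
    {z w : ℍ} (n : ℤ) (h : (w : ℂ) = z + n) : f w = f z := by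
  have h1 : Periodic.qParam 1 (w : ℂ) = Periodic.qParam 1 (z : ℂ) := by
    simp only [Periodic.qParam]
    rw [Complex.exp_eq_exp_iff_exists_int]
    exact ⟨n, by rw [h]; push_cast; ring⟩
  refine (hf w).unique ?_
  rw [h1]
  exact hf z

theorem HasQExp.slash_T {f : ℍ → ℂ} {p : PowerSeries ℂ} (hf : HasQExp f p) (k : ℤ) :
    f ∣[k] ModularGroup.T = f := by
  funext z
  rw [ModularForm.SL_slash_apply]
  have h1 : denom ModularGroup.T z = 1 := by
    rw [denom_SL]; simp [ModularGroup.coe_T]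
  rw [h1, one_zpow, mul_one]
  exact hf.apply_eq_of_eq_add_int 1 (by rw [coe_SL_smul]; simp [ModularGroup.coe_T])

/-! ### Functions whose square is modular -/

section SquareRoot

variable {f : ℍ → ℂ} {k : ℤ} {Γ : Subgroup SL(2, ℤ)}

/-- The product `(f∣γ - f)(f∣γ + f)` is zero, and holomorphic functions on the upper half plane have
no zero divisors. -/
theorem slash_eq_or_eq_neg (hf : MDiff f) (h : IsModForm Γ (k + k) (f * f)) {γ : SL(2, ℤ)}
    (hγ : γ ∈ Γ) : f ∣[k] γ = f ∨ f ∣[k] γ = -f := by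
  have h1 := h.slash γ hγ
  rw [ModularForm.mul_slash_SL2] at h1
  have hd : MDiff (f ∣[k] γ) := by
    rw [ModularForm.SL_slash]; exact hf.slash k _
  have h2 : (f ∣[k] γ - f) * (f ∣[k] γ + f) = 0 := by
    linear_combination h1
  rcases (UpperHalfPlane.mul_eq_zero_iff (hd.sub hf) (hd.add hf)).mp h2 with h3 | h3
  · exact .inl (sub_eq_zero.mp h3)
  · exact .inr (eq_neg_of_add_eq_zero_left h3)

theorem bdd_of_mul_self (h : IsModForm Γ (k + k) (f * f)) (γ : SL(2, ℤ)) :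
    IsBoundedAtImInfty (f ∣[k] γ) := by
  have h1 := h.bdd γ
  rw [ModularForm.mul_slash_SL2, ← sq] at h1
  exact IsBigO.of_pow two_ne_zero (by simpa [IsBoundedAtImInfty, BoundedAtFilter] using! h1)

end SquareRoot

/-! ### The eta quotients of the identity and their common group -/

/-- The exponents of an eta quotient, as a function on the divisors of `42`. -/
def exps (a₁ a₂ a₃ a₆ a₇ a₁₄ a₂₁ a₄₂ : ℤ) (δ : ℕ) : ℤ :=
  if δ = 1 then a₁ else if δ = 2 then a₂ else if δ = 3 then a₃ else if δ = 6 then a₆ else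
  if δ = 7 then a₇ else if δ = 14 then a₁₄ else if δ = 21 then a₂₁ else if δ = 42 then a₄₂ else 0

theorem etaQuot_exps (a₁ a₂ a₃ a₆ a₇ a₁₄ a₂₁ a₄₂ : ℤ) (z : ℍ) :
    etaQuot (exps a₁ a₂ a₃ a₆ a₇ a₁₄ a₂₁ a₄₂) z =
      (etaAt 1 z ^ 2) ^ a₁ * ((etaAt 2 z ^ 2) ^ a₂ * ((etaAt 3 z ^ 2) ^ a₃ *
      ((etaAt 6 z ^ 2) ^ a₆ * ((etaAt 7 z ^ 2) ^ a₇ * ((etaAt 14 z ^ 2) ^ a₁₄ *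
      ((etaAt 21 z ^ 2) ^ a₂₁ * (etaAt 42 z ^ 2) ^ a₄₂)))))) := by
  simp [etaQuot, divisors42, exps]

section Forms

variable {k : ℤ} {f : ℍ → ℂ}

theorem isModForm_of_etaQuot_eq {s : ℕ → ℤ} (h : ∀ z, etaQuot s z = f z)
    (hk : ∑ δ ∈ divisors42, s δ = k) (hs : TrivialMult s) (hs' : NonnegOrder s) :
    IsModForm (Gamma0 42) k f := by
  rw [← funext h]
  exact isModForm_etaQuot hk hs hs'

theorem isModForm_etaC2 : IsModForm (Gamma0 42) 4 etaC2 :=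
  isModForm_of_etaQuot_eq (s := exps 1 1 0 0 1 1 0 0)
    (fun z ↦ by simp [etaQuot_exps, etaC2]; ring) (by decide) (by decide +kernel)
    (by decide +kernel)

theorem isModForm_etaC3 : IsModForm (Gamma0 42) 4 etaC3 :=
  isModForm_of_etaQuot_eq (s := exps 3 (-1) 0 0 (-1) 3 0 0)
    (fun z ↦ by simp only [etaQuot_exps, etaC3, zpow_neg, zpow_ofNat]; simp; field_simp)
    (by decide) (by decide +kernel) (by decide +kernel)

theorem isModForm_etaC4 : IsModForm (Gamma0 42) 4 etaC4 :=
  isModForm_of_etaQuot_eq (s := exps (-1) 3 0 0 3 (-1) 0 0)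
    (fun z ↦ by simp only [etaQuot_exps, etaC4, zpow_neg, zpow_ofNat]; simp; field_simp)
    (by decide) (by decide +kernel) (by decide +kernel)

theorem isModForm_etaC5 : IsModForm (Gamma0 42) 4 etaC5 :=
  isModForm_of_etaQuot_eq (s := exps 1 1 1 1 0 0 0 0)
    (fun z ↦ by simp [etaQuot_exps, etaC5]; ring) (by decide) (by decide +kernel)
    (by decide +kernel)

theorem isModForm_etaC8 : IsModForm (Gamma0 42) 4 etaC8 :=
  isModForm_of_etaQuot_eq (s := exps 0 0 0 0 1 1 1 1)
    (fun z ↦ by simp [etaQuot_exps, etaC8]; ring) (by decide) (by decide +kernel)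
    (by decide +kernel)

theorem isModForm_etaC10 : IsModForm (Gamma0 42) 4 etaC10 :=
  isModForm_of_etaQuot_eq (s := exps 0 1 0 1 1 0 1 0)
    (fun z ↦ by simp [etaQuot_exps, etaC10]; ring) (by decide) (by decide +kernel)
    (by decide +kernel)

theorem isModForm_etaC17 : IsModForm (Gamma0 42) 4 etaC17 :=
  isModForm_of_etaQuot_eq (s := exps 0 0 (-1) 3 0 0 3 (-1))
    (fun z ↦ by simp only [etaQuot_exps, etaC17, zpow_neg, zpow_ofNat]; simp; field_simp)
    (by decide) (by decide +kernel) (by decide +kernel)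

theorem isModForm_etaC19 : IsModForm (Gamma0 42) 4 etaC19 :=
  isModForm_of_etaQuot_eq (s := exps 0 0 1 1 0 0 1 1)
    (fun z ↦ by simp [etaQuot_exps, etaC19]; ring) (by decide) (by decide +kernel)
    (by decide +kernel)

theorem etaAt_scale (t δ : ℕ) [NeZero t] (z : ℍ) : etaAt δ (scale t z) = etaAt (δ * t) z := by
  simp [etaAt, mul_assoc]

/-- Checked directly as an eta quotient: scaling `isModForm_etaC3` by 3 would only give level 126.
-/
theorem isModForm_etaC3_scale : IsModForm (Gamma0 42) 4 fun z ↦ etaC3 (scale 3 z) :=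
  isModForm_of_etaQuot_eq (s := exps 0 0 3 (-1) 0 0 (-1) 3)
    (fun z ↦ by
      simp only [etaQuot_exps, etaC3, zpow_neg, zpow_ofNat, etaAt_scale]; simp; field_simp)
    (by decide) (by decide +kernel) (by decide +kernel)

theorem etaC2_scale (z : ℍ) : etaC2 (scale 3 z) = etaC19 z := by
  simp [etaC2, etaC19, etaAt_scale]

theorem etaC4_scale (z : ℍ) : etaC4 (scale 3 z) = etaC17 z := by
  simp [etaC4, etaC17, etaAt_scale]

theorem isModForm_etaC6_mul_self : IsModForm (Gamma0 42) (4 + 4) (etaC6 * etaC6) :=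
  isModForm_of_etaQuot_eq (s := exps 0 1 3 0 1 0 0 3)
    (fun z ↦ by simp only [etaQuot_exps, etaC6, zpow_ofNat, Pi.mul_apply]; simp; ring)
    (by decide) (by decide +kernel) (by decide +kernel)

theorem isModForm_etaC7_mul_self : IsModForm (Gamma0 42) (4 + 4) (etaC7 * etaC7) :=
  isModForm_of_etaQuot_eq (s := exps 1 0 0 3 0 1 3 0)
    (fun z ↦ by simp only [etaQuot_exps, etaC7, zpow_ofNat, Pi.mul_apply]; simp; ring)
    (by decide) (by decide +kernel) (by decide +kernel)

theorem isModForm_etaC12_mul_self : IsModForm (Gamma0 42) (4 + 4) (etaC12 * etaC12) :=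
  isModForm_of_etaQuot_eq (s := exps 3 0 0 1 0 3 1 0)
    (fun z ↦ by simp only [etaQuot_exps, etaC12, zpow_ofNat, Pi.mul_apply]; simp; ring)
    (by decide) (by decide +kernel) (by decide +kernel)

theorem mdifferentiable_etaC6 : MDiff etaC6 := by
  have h (δ : ℕ) (hδ : 0 < δ) := mdifferentiable_etaAt hδ
  exact (((h 2 (by simp)).mul ((h 3 (by simp)).pow 3)).mul (h 7 (by simp))).mul
    ((h 42 (by simp)).pow 3)

theorem mdifferentiable_etaC7 : MDiff etaC7 := by
  have h (δ : ℕ) (hδ : 0 < δ) := mdifferentiable_etaAt hδ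
  exact (((h 1 (by simp)).mul ((h 6 (by simp)).pow 3)).mul (h 14 (by simp))).mul
    ((h 21 (by simp)).pow 3)

theorem mdifferentiable_etaC12 : MDiff etaC12 := by
  have h (δ : ℕ) (hδ : 0 < δ) := mdifferentiable_etaAt hδ
  exact ((((h 1 (by simp)).pow 3).mul (h 6 (by simp))).mul ((h 14 (by simp)).pow 3)).mul
    (h 21 (by simp))

theorem hasQExp_eulerProd_scale (δ : ℕ) [NeZero δ] :
    HasQExp (fun z ↦ eulerProd (scale δ z)) (dilate δ (PowerSeries.pentagonalSeries ℂ)) :=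
  hasQExp_eulerProd.scale δ

/-- The subgroup of `Γ₀(42)` fixing `C₆` and `C₇`. -/
noncomputable def levelGroup : Subgroup SL(2, ℤ) :=
  slashStabilizer 4 etaC6 ⊓ slashStabilizer 4 etaC7 ⊓ Gamma0 42

theorem levelGroup_le : levelGroup ≤ Gamma0 42 := inf_le_right

/-- The exponents give `(2 + 3·3 + 7 + 3·42) / 24 = 6`, an integer power of `q`, so the sign under
translation is `+1`. Expansions in `q` thus remain available on the smaller group. -/
theorem T_mem_slashStabilizer_etaC6 : ModularGroup.T ∈ slashStabilizer 4 etaC6 := by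
  have h (δ : ℕ) [NeZero δ] := hasQExp_eulerProd_scale δ
  refine HasQExp.slash_T (((HasQExp.qParam_pow 6).mul
    ((((h 2).mul ((h 3).pow 3)).mul (h 7)).mul ((h 42).pow 3))).congr fun z ↦ ?_) 4
  simp only [etaC6, etaAt_eq, ← qParam_24_pow]
  ring

theorem T_mem_slashStabilizer_etaC7 : ModularGroup.T ∈ slashStabilizer 4 etaC7 := by
  have h (δ : ℕ) [NeZero δ] := hasQExp_eulerProd_scale δ
  refine HasQExp.slash_T (((HasQExp.qParam_pow 4).mul
    ((((h 1).mul ((h 6).pow 3)).mul (h 14)).mul ((h 21).pow 3))).congr fun z ↦ ?_) 4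
  simp only [etaC7, etaAt_eq, ← qParam_24_pow]
  ring

theorem T_mem_levelGroup : ModularGroup.T ∈ levelGroup :=
  ⟨⟨T_mem_slashStabilizer_etaC6, T_mem_slashStabilizer_etaC7⟩, by
    simp [CongruenceSubgroup.Gamma0_mem, ModularGroup.coe_T]⟩

theorem index_levelGroup_le : levelGroup.index ≤ 384 := by
  rw [← Subgroup.relIndex_mul_index levelGroup_le, levelGroup, Subgroup.inf_relIndex_right]
  have h1 := Subgroup.relIndex_inf_le (H := slashStabilizer 4 etaC6) (K := slashStabilizer 4 etaC7)
    (L := Gamma0 42)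
  have h6 := (relIndex_slashStabilizer fun γ (hγ : γ ∈ Gamma0 42) ↦
    slash_eq_or_eq_neg mdifferentiable_etaC6 isModForm_etaC6_mul_self hγ).2
  have h7 := (relIndex_slashStabilizer fun γ (hγ : γ ∈ Gamma0 42) ↦
    slash_eq_or_eq_neg mdifferentiable_etaC7 isModForm_etaC7_mul_self hγ).2
  calc _ ≤ (2 * 2) * 96 := Nat.mul_le_mul (h1.trans (Nat.mul_le_mul h6 h7)) index_Gamma0_42_le
    _ = 384 := by norm_num

instance : levelGroup.FiniteIndex := by
  refine ⟨?_⟩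
  rw [← Subgroup.relIndex_mul_index levelGroup_le, levelGroup, Subgroup.inf_relIndex_right]
  exact mul_ne_zero (Subgroup.relIndex_inf_ne_zero
    (relIndex_slashStabilizer fun _ ↦
      slash_eq_or_eq_neg mdifferentiable_etaC6 isModForm_etaC6_mul_self).1
    (relIndex_slashStabilizer fun _ ↦
      slash_eq_or_eq_neg mdifferentiable_etaC7 isModForm_etaC7_mul_self).1)
    Subgroup.FiniteIndex.index_ne_zero

theorem isModForm_etaC6 : IsModForm levelGroup 4 etaC6 :=
  ⟨mdifferentiable_etaC6, fun _ hγ ↦ hγ.1.1, bdd_of_mul_self isModForm_etaC6_mul_self⟩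

theorem isModForm_etaC7 : IsModForm levelGroup 4 etaC7 :=
  ⟨mdifferentiable_etaC7, fun _ hγ ↦ hγ.1.2, bdd_of_mul_self isModForm_etaC7_mul_self⟩

theorem isModForm_etaC12 : IsModForm levelGroup 4 etaC12 := by
  refine ⟨mdifferentiable_etaC12, fun γ hγ ↦ ?_, bdd_of_mul_self isModForm_etaC12_mul_self⟩
  -- The cofactor `(η(z) η(14z) / (η(6z) η(21z)))²` has weight 0 and trivial multiplier on `Γ₀(42)`,
  -- so `C₁₂` transforms with the same sign as `C₇`. Only its invariance is used; boundedness of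
  -- `C₁₂` comes from its square.
  have h1 : etaC12 = etaC7 * etaQuot (exps 1 0 0 (-1) 0 1 (-1) 0) := funext fun z ↦ by
    have h6 := etaAt_ne_zero (δ := 6) (by simp) z
    have h21 := etaAt_ne_zero (δ := 21) (by simp) z
    simp only [etaQuot_exps, etaC7, etaC12, zpow_neg, Pi.mul_apply]
    simp
    field_simp
  have h2 := etaQuot_slash (s := exps 1 0 0 (-1) 0 1 (-1) 0) (k := 0) (by decide)
    (by decide +kernel) (levelGroup_le hγ)
  rw [h1, show (4 : ℤ) = 4 + 0 by rfl, ModularForm.mul_slash_SL2, h2, isModForm_etaC7.slash γ hγ]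

end Forms

/-! ### The theta function of the hexagonal lattice -/

/-- A function given by a sum of powers of `q` has the expansion counting the exponents. -/
theorem hasQExp_of_hasSum {ι : Type*} {Q : ι → ℕ} {f : ℍ → ℂ}
    (h : ∀ τ : ℍ, HasSum (fun v ↦ Periodic.qParam 1 (τ : ℂ) ^ Q v) (f τ)) :
    HasQExp f (.mk fun n ↦ (Nat.card {v // Q v = n} : ℂ)) := by
  intro τ
  have h1 := (Equiv.sigmaFiberEquiv Q).hasSum_iff.mpr (h τ)
  refine h1.sigma fun n ↦ ?_
  have h2 : ∀ v : {v // Q v = n}, ((fun v ↦ Periodic.qParam 1 (τ : ℂ) ^ Q v) ∘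
      Equiv.sigmaFiberEquiv Q) ⟨n, v⟩ = Periodic.qParam 1 (τ : ℂ) ^ n := fun v ↦ by
    simp [Equiv.sigmaFiberEquiv, v.2]
  have h3 := h1.summable.sigma_factor n
  simp only [h2] at h3 ⊢
  -- Summability forces finite fibres: on a fibre the summand is the nonzero constant `q^n`.
  have h4 : Finite {v // Q v = n} := by
    by_contra hinf
    rw [not_finite_iff_infinite] at hinf
    exact pow_ne_zero n (Periodic.qParam_ne_zero (h := 1) (τ : ℂ)) ((summable_const_iff _).mp h3)
  have := Fintype.ofFinite {v // Q v = n}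
  convert! hasSum_fintype (fun _ : {v // Q v = n} ↦ Periodic.qParam 1 (τ : ℂ) ^ n)
  simp

theorem HasQExp.mdifferentiable {f : ℍ → ℂ} {p : PowerSeries ℂ} (hf : HasQExp f p) : MDiff f := by
  rw [UpperHalfPlane.mdifferentiable_iff]
  have h1 := hf.hasFPowerSeriesOnBall.differentiableOn
  have h2 : DifferentiableOn ℂ (Periodic.qParam 1) {z : ℂ | 0 < z.im} := by
    unfold Periodic.qParam; fun_prop
  refine (h1.comp h2 fun z hz ↦ ?_).congr fun z hz ↦ ?_
  · rw [← ENNReal.coe_one, Metric.eball_coe, NNReal.coe_one, mem_ball_zero_iff]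
    exact norm_qParam_lt_one ⟨z, hz⟩
  · simp only [comp_apply, ofComplex_apply_of_im_pos hz]
    exact (hf ⟨z, hz⟩).tsum_eq.symm

theorem HasQExp.isBoundedAtImInfty {f : ℍ → ℂ} {p : PowerSeries ℂ} (hf : HasQExp f p) :
    IsBoundedAtImInfty f := by
  have h := hf.isBigO_of_coeff_eq_zero (N := 0) (by simp)
  simp only [pow_zero] at h
  exact h.trans (.of_bound 1 (by simp))

/-- The quadratic form `x² + xy + y²`. -/
def hexForm (v : ℤ × ℤ) : ℕ := (v.1 ^ 2 + v.1 * v.2 + v.2 ^ 2).toNat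

theorem coe_hexForm (v : ℤ × ℤ) : (hexForm v : ℤ) = v.1 ^ 2 + v.1 * v.2 + v.2 ^ 2 :=
  Int.toNat_of_nonneg (by nlinarith [sq_nonneg (v.1 + v.2)])

theorem coe_hexForm_complex (v : ℤ × ℤ) :
    (hexForm v : ℂ) = (v.1 : ℂ) ^ 2 + v.1 * v.2 + (v.2 : ℂ) ^ 2 := by
  exact_mod_cast congrArg (Int.cast : ℤ → ℂ) (coe_hexForm v)

theorem summable_norm_jacobi (z : ℂ) {τ : ℂ} (hτ : 0 < τ.im) :
    Summable fun n ↦ ‖jacobiTheta₂_term n z τ‖ :=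
  ((summable_jacobiTheta₂_term_iff z τ).mpr hτ).norm

theorem summable_norm_hexForm (τ : ℍ) :
    Summable fun v ↦ ‖Periodic.qParam 1 (τ : ℂ) ^ hexForm v‖ := by
  have h1 := summable_norm_jacobi 0 τ.2
  refine Summable.of_nonneg_of_le (fun _ ↦ norm_nonneg _) (fun v ↦ ?_)
    (h1.mul_of_nonneg h1 (fun _ ↦ norm_nonneg _) fun _ ↦ norm_nonneg _)
  simp only [norm_pow, Periodic.norm_qParam, norm_jacobiTheta₂_term, ← Real.exp_nat_mul,
    ← Real.exp_add]
  refine Real.exp_le_exp.mpr ?_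
  have h2 : (hexForm v : ℝ) = (v.1 : ℝ) ^ 2 + v.1 * v.2 + (v.2 : ℝ) ^ 2 := by
    exact_mod_cast congrArg (Int.cast : ℤ → ℝ) (coe_hexForm v)
  have h3 : 0 < π * τ.im := mul_pos Real.pi_pos τ.im_pos
  simp only [h2, Complex.zero_im, mul_zero, sub_zero, div_one, coe_im]
  -- The Gaussian majorant rests on `2(x² + xy + y²) = x² + y² + (x + y)²`.
  nlinarith [mul_nonneg h3.le (sq_nonneg ((v.1 : ℝ) + v.2))]

/-- The theta function `∑ q ^ (x² + xy + y²)` of the hexagonal lattice. -/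
noncomputable def hexTheta (τ : ℍ) : ℂ := ∑' v : ℤ × ℤ, Periodic.qParam 1 (τ : ℂ) ^ hexForm v

theorem hasSum_hexTheta (τ : ℍ) :
    HasSum (fun v ↦ Periodic.qParam 1 (τ : ℂ) ^ hexForm v) (hexTheta τ) :=
  (summable_norm_hexForm τ).of_norm.hasSum

theorem hasQExp_hexTheta :
    HasQExp hexTheta (.mk fun n ↦ (Nat.card {v // hexForm v = n} : ℂ)) :=
  hasQExp_of_hasSum hasSum_hexTheta

theorem qParam_pow_hexForm (τ : ℂ) (v : ℤ × ℤ) : Periodic.qParam 1 τ ^ hexForm v =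
    Complex.exp (2 * π * Complex.I * τ * ((v.1 : ℂ) ^ 2 + v.1 * v.2 + (v.2 : ℂ) ^ 2)) := by
  rw [Periodic.qParam, ← Complex.exp_nat_mul, coe_hexForm_complex]
  congr 1; push_cast; ring

/-- The inversion formula for `hexTheta`, from the functional equation of `jacobiTheta₂` in each
of the two variables. -/
theorem hexTheta_eq_inversion (τ τ' : ℍ) (h : (τ' : ℂ) = -1 / (3 * τ)) :
    hexTheta τ = 1 / (-Complex.I * (2 * τ)) ^ (1 / 2 : ℂ) *
      (1 / (-Complex.I * (3 * τ / 2)) ^ (1 / 2 : ℂ) * hexTheta τ') := by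
  have hτ0 : (τ : ℂ) ≠ 0 := τ.ne_zero
  have him : 0 < (3 * (τ : ℂ) / 2).im := by
    have := τ.im_pos
    rw [show 3 * (τ : ℂ) / 2 = ((3 / 2 : ℝ) : ℂ) * τ by push_cast; ring, Complex.im_ofReal_mul]
    simpa using this
  have him' : 0 < (-1 / (2 * (τ : ℂ))).im := by
    have : (-1 / (2 * (τ : ℂ))) = ((3 / 2 : ℝ) : ℂ) * τ' := by rw [h]; push_cast; field_simp
    rw [this, Complex.im_ofReal_mul]
    simpa using τ'.im_pos
  -- The double series left after Poisson summation in `x`, with dual variable `m`. Completing the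
  -- square leaves Gaussians in `y` and `m` of parameters `3τ/2` and `-1/(2τ)`, coupled only by a
  -- phase of modulus 1, so the order of summation may be exchanged.
  set g : ℤ → ℤ → ℂ := fun y m ↦
    Complex.exp (π * Complex.I * m * y) * (jacobiTheta₂_term y 0 (3 * τ / 2) *
      jacobiTheta₂_term m 0 (-1 / (2 * τ))) with hg
  have hgs : Summable (uncurry g) := by
    refine .of_norm_bounded ((summable_norm_jacobi 0 him).mul_of_nonneg
      (summable_norm_jacobi 0 him') (fun _ ↦ norm_nonneg _) fun _ ↦ norm_nonneg _) fun v ↦ ?_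
    have : ‖Complex.exp (π * Complex.I * v.2 * v.1)‖ = 1 := by
      rw [show (π * Complex.I * v.2 * v.1 : ℂ) = ((π * v.2 * v.1 : ℝ) : ℂ) * Complex.I by
        push_cast; ring, Complex.norm_exp_ofReal_mul_I]
    simp [uncurry, hg, this]
  have hrow (y : ℤ) : ∑' x : ℤ, Periodic.qParam 1 (τ : ℂ) ^ hexForm (y, x) =
      1 / (-Complex.I * (2 * τ)) ^ (1 / 2 : ℂ) * ∑' m, g y m := by
    have h1 : ∑' x : ℤ, Periodic.qParam 1 (τ : ℂ) ^ hexForm (y, x) =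
        Complex.exp (2 * π * Complex.I * τ * y ^ 2) * jacobiTheta₂ (y * τ) (2 * τ) := by
      rw [jacobiTheta₂, ← tsum_mul_left]
      refine tsum_congr fun x ↦ ?_
      rw [qParam_pow_hexForm, jacobiTheta₂_term, ← Complex.exp_add]
      congr 1; ring
    rw [h1, jacobiTheta₂_functional_equation, jacobiTheta₂, ← tsum_mul_left, ← tsum_mul_left,
      ← tsum_mul_left]
    refine tsum_congr fun m ↦ ?_
    simp only [hg, jacobiTheta₂_term]
    rw [mul_assoc (1 / _) (Complex.exp _), mul_left_comm (Complex.exp _) (1 / _)]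
    congr 1
    simp only [← Complex.exp_add]
    congr 1
    field_simp
    ring
  -- Second Poisson summation, in `y`: the phase `exp (πi m y)` makes the inner sum a Jacobi theta
  -- value at `m / 2`.
  have hcol (m : ℤ) : ∑' y, g y m = 1 / (-Complex.I * (3 * τ / 2)) ^ (1 / 2 : ℂ) *
      ∑' n : ℤ, Periodic.qParam 1 (τ' : ℂ) ^ hexForm (m, n) := by
    have h1 : ∑' y, g y m = jacobiTheta₂_term m 0 (-1 / (2 * τ)) *
        jacobiTheta₂ (m / 2) (3 * τ / 2) := by
      rw [jacobiTheta₂, ← tsum_mul_left]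
      refine tsum_congr fun y ↦ ?_
      simp only [hg, jacobiTheta₂_term, ← Complex.exp_add]
      congr 1; ring
    rw [h1, jacobiTheta₂_functional_equation, ← jacobiTheta₂_neg_left, jacobiTheta₂,
      ← tsum_mul_left, ← tsum_mul_left, ← tsum_mul_left]
    refine tsum_congr fun n ↦ ?_
    simp only [jacobiTheta₂_term, qParam_pow_hexForm, h]
    rw [mul_assoc (1 / _) (Complex.exp _), mul_left_comm (Complex.exp _) (1 / _)]
    congr 1
    simp only [← Complex.exp_add]
    congr 1
    field_simp
    ring
  calc hexTheta τ = ∑' y : ℤ, ∑' x : ℤ, Periodic.qParam 1 (τ : ℂ) ^ hexForm (y, x) :=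
        (summable_norm_hexForm τ).of_norm.tsum_prod
    _ = 1 / (-Complex.I * (2 * τ)) ^ (1 / 2 : ℂ) * ∑' m, ∑' y, g y m := by
        rw [tsum_congr hrow, tsum_mul_left, hgs.tsum_comm]
    _ = _ := by
        rw [tsum_congr hcol, tsum_mul_left, hexTheta, (summable_norm_hexForm τ').of_norm.tsum_prod]

/-- The theta function of `x₁² + x₁x₂ + x₂² + x₃² + x₃x₄ + x₄²`. -/
noncomputable def hexThetaSq (τ : ℍ) : ℂ := hexTheta τ ^ 2

/-- Squaring removes the branches of the square roots: the factors `-2iτ` and `-3iτ/2` multiply to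
`-3τ²`. -/
theorem hexThetaSq_inversion (τ τ' : ℍ) (h : (τ' : ℂ) = -1 / (3 * τ)) :
    hexThetaSq τ' = -3 * τ ^ 2 * hexThetaSq τ := by
  have hτ0 : (τ : ℂ) ≠ 0 := τ.ne_zero
  have hsq (w : ℂ) : (w ^ (1 / 2 : ℂ)) ^ 2 = w := by
    rw [one_div, show (2 : ℂ) = ((2 : ℕ) : ℂ) by rfl, Complex.cpow_nat_inv_pow _ two_ne_zero]
  rw [hexThetaSq, hexThetaSq, hexTheta_eq_inversion τ τ' h, mul_pow, mul_pow, div_pow, div_pow,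
    hsq, hsq]
  field_simp
  rw [Complex.I_sq]
  ring

theorem hasQExp_hexThetaSq :
    HasQExp hexThetaSq ((.mk fun n ↦ (Nat.card {v // hexForm v = n} : ℂ)) ^ 2) :=
  hasQExp_hexTheta.pow 2

theorem hexThetaSq_add_int {z w : ℍ} (n : ℤ) (h : (w : ℂ) = z + n) :
    hexThetaSq w = hexThetaSq z := hasQExp_hexThetaSq.apply_eq_of_eq_add_int n h

theorem coe_S_smul (z : ℍ) : ((ModularGroup.S • z : ℍ) : ℂ) = -1 / z := by
  rw [coe_SL_smul]; simp [ModularGroup.coe_S]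

theorem coe_S_smul_scale (z : ℍ) : ((ModularGroup.S • scale 3 z : ℍ) : ℂ) = -1 / (3 * z) := by
  rw [coe_S_smul]; simp

/-- Invariance of `hexThetaSq` under the matrices with rows `(1, 0)` and `(3n, 1)`. -/
theorem hexThetaSq_lower {u w : ℍ} (n : ℤ) {d : ℂ} (hd : d = 3 * n * u + 1) (h : (w : ℂ) = u / d) :
    hexThetaSq w = d ^ 2 * hexThetaSq u := by
  have hu : (u : ℂ) ≠ 0 := u.ne_zero
  have hw : (w : ℂ) ≠ 0 := w.ne_zero
  have hd0 : d ≠ 0 := by rintro rfl; simp [h] at hw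
  have h1 := hexThetaSq_inversion u _ (coe_S_smul_scale u)
  have h2 := hexThetaSq_inversion w _ (coe_S_smul_scale w)
  -- Under `z ↦ -1/(3z)` the lower triangular matrix becomes an integer translation.
  have h3 : hexThetaSq (ModularGroup.S • scale 3 u) = hexThetaSq (ModularGroup.S • scale 3 w) := by
    refine hexThetaSq_add_int n ?_
    rw [coe_S_smul_scale, coe_S_smul_scale, h]
    field_simp
    rw [hd]; ring
  rw [h1, h2, h] at h3
  field_simp at h3
  linear_combination h3

/-- `hexThetaSq ((z + j) / 3)`. -/
noncomputable def hexThetaThird (j : ℕ) (z : ℍ) : ℂ := hexThetaSq (affineMap 1 3 j z)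

theorem slash_T_apply (k : ℤ) (f : ℍ → ℂ) (z : ℍ) :
    (f ∣[k] ModularGroup.T) z = f (ModularGroup.T • z) := by
  rw [ModularForm.SL_slash_apply, denom_SL]
  simp [ModularGroup.coe_T]

theorem slash_S_apply (f : ℍ → ℂ) (z : ℍ) :
    (f ∣[(2 : ℤ)] ModularGroup.S) z = f (ModularGroup.S • z) / (z : ℂ) ^ 2 := by
  rw [ModularForm.SL_slash_apply, ModularGroup.denom_S, zpow_neg, div_eq_mul_inv]
  rfl

theorem coe_T_smul (z : ℍ) : ((ModularGroup.T • z : ℍ) : ℂ) = z + 1 := by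
  rw [coe_SL_smul]; simp [ModularGroup.coe_T]

theorem hexThetaThird_slash_T (j : ℕ) :
    hexThetaThird j ∣[(2 : ℤ)] ModularGroup.T = hexThetaThird (j + 1) := funext fun z ↦ by
  rw [slash_T_apply]
  refine hexThetaSq_add_int 0 ?_
  simp only [coe_affineMap, coe_T_smul]
  push_cast; ring

theorem hexThetaThird_add_three (j : ℕ) : hexThetaThird (j + 3) = hexThetaThird j :=
    funext fun z ↦ by
  refine hexThetaSq_add_int 1 ?_
  simp only [coe_affineMap]
  push_cast; ring

theorem hexThetaSq_slash_T : hexThetaSq ∣[(2 : ℤ)] ModularGroup.T = hexThetaSq :=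
  hasQExp_hexThetaSq.slash_T 2

theorem hexThetaSq_slash_S :
    hexThetaSq ∣[(2 : ℤ)] ModularGroup.S = (-1 / 3 : ℂ) • hexThetaThird 0 := funext fun z ↦ by
  have hz : (z : ℂ) ≠ 0 := z.ne_zero
  rw [slash_S_apply, hexThetaSq_inversion (affineMap 1 3 (0 : ℕ) z) (ModularGroup.S • z)]
  · simp only [Pi.smul_apply, smul_eq_mul, hexThetaThird, coe_affineMap]
    push_cast
    field_simp
    ring
  · rw [coe_S_smul]
    simp only [coe_affineMap]
    congr 1
    push_cast
    ring

theorem hexThetaThird_zero_slash_S :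
    hexThetaThird 0 ∣[(2 : ℤ)] ModularGroup.S = (-3 : ℂ) • hexThetaSq := funext fun z ↦ by
  have hz : (z : ℂ) ≠ 0 := z.ne_zero
  rw [slash_S_apply, hexThetaThird, hexThetaSq_inversion z]
  · simp only [Pi.smul_apply, smul_eq_mul]
    field_simp
  · simp only [coe_affineMap, coe_S_smul]
    push_cast
    field_simp
    ring

theorem hexThetaThird_one_slash_S :
    hexThetaThird 1 ∣[(2 : ℤ)] ModularGroup.S = hexThetaThird 2 := funext fun z ↦ by
  have hz : (z : ℂ) ≠ 0 := z.ne_zero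
  have h1 : hexThetaThird 2 z = hexThetaSq (affineMap 1 3 (-1) z) := by
    refine hexThetaSq_add_int 1 ?_
    simp only [coe_affineMap]
    push_cast; ring
  rw [slash_S_apply, h1, hexThetaThird,
    hexThetaSq_lower (u := affineMap 1 3 (-1) z) 1 (d := z)]
  · field_simp
  · simp only [coe_affineMap]; push_cast; ring
  · simp only [coe_affineMap, coe_S_smul]; push_cast; field_simp; ring

theorem hexThetaThird_two_slash_S :
    hexThetaThird 2 ∣[(2 : ℤ)] ModularGroup.S = hexThetaThird 1 := funext fun z ↦ by
  have hz : (z : ℂ) ≠ 0 := z.ne_zero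
  have h1 : hexThetaThird 2 (ModularGroup.S • z) =
      hexThetaSq (affineMap 1 3 (-1) (ModularGroup.S • z)) := by
    refine hexThetaSq_add_int 1 ?_
    simp only [coe_affineMap]
    push_cast; ring
  rw [slash_S_apply, h1, hexThetaSq_lower (u := affineMap 1 3 (1 : ℕ) z) (-1) (d := -z)]
  · rw [hexThetaThird]; field_simp
  · simp only [coe_affineMap]; push_cast; ring
  · simp only [coe_affineMap, coe_S_smul]; push_cast; field_simp; ring

/-- The transform of `hexThetaSq` under a matrix with lower row `(c, d)` modulo `3`. -/
noncomputable def hexThetaOrbit (c d : ZMod 3) : ℍ → ℂ :=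
  if c = 0 then hexThetaSq else (-1 / 3 : ℂ) • hexThetaThird (d * c).val

theorem hexThetaOrbit_of_ne {c d : ZMod 3} (hc : c ≠ 0) (j : ℕ) (hj : (d * c).val = j) :
    hexThetaOrbit c d = (-1 / 3 : ℂ) • hexThetaThird j := by
  rw [hexThetaOrbit, if_neg hc, hj]

/-- The transforms of `θ²` are indexed by `(c : d)` in `ℙ¹(𝔽₃)`. For `c ≠ 0` the coordinate is `d /
c`, which equals `d * c` because `c⁻¹ = c` in `𝔽₃`; `T` raises it by one. -/
theorem hexThetaOrbit_slash_T (c d : ZMod 3) :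
    hexThetaOrbit c d ∣[(2 : ℤ)] ModularGroup.T = hexThetaOrbit c (c + d) := by
  by_cases hc : c = 0
  · simp [hexThetaOrbit, hc, hexThetaSq_slash_T]
  · have h : (d * c).val + 1 = ((c + d) * c).val ∨ (d * c).val + 1 = ((c + d) * c).val + 3 := by
      revert c d; decide
    rw [hexThetaOrbit_of_ne hc _ rfl, hexThetaOrbit_of_ne hc _ rfl, ModularForm.SL_smul_slash,
      hexThetaThird_slash_T]
    rcases h with h | h
    · rw [h]
    · rw [h, hexThetaThird_add_three]

theorem hexThetaOrbit_slash_S {c d : ZMod 3} (h : c ≠ 0 ∨ d ≠ 0) :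
    hexThetaOrbit c d ∣[(2 : ℤ)] ModularGroup.S = hexThetaOrbit d (-c) := by
  by_cases hc : c = 0
  · subst hc
    have hd : d ≠ 0 := h.resolve_left (by simp)
    rw [hexThetaOrbit_of_ne hd 0 (by simp)]
    simp [hexThetaOrbit, hexThetaSq_slash_S]
  by_cases hd : d = 0
  · subst hd
    rw [hexThetaOrbit_of_ne hc 0 (by simp), ModularForm.SL_smul_slash, hexThetaThird_zero_slash_S,
      smul_smul]
    norm_num [hexThetaOrbit]
  · have h1 : ((d * c).val = 1 ∧ (-c * d).val = 2) ∨ ((d * c).val = 2 ∧ (-c * d).val = 1) := by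
      revert c d; decide
    rcases h1 with ⟨h1, h2⟩ | ⟨h1, h2⟩
    · rw [hexThetaOrbit_of_ne hc _ h1, hexThetaOrbit_of_ne hd _ h2, ModularForm.SL_smul_slash,
        hexThetaThird_one_slash_S]
    · rw [hexThetaOrbit_of_ne hc _ h1, hexThetaOrbit_of_ne hd _ h2, ModularForm.SL_smul_slash,
        hexThetaThird_two_slash_S]

/-- The generators act on the family `hexThetaOrbit` as they act on lower rows modulo 3, with no
sign left over. Hence `θ²` has trivial character on `Γ₀(3)`, and all its transforms are visibly
bounded. -/
theorem hexThetaSq_slash (γ : SL(2, ℤ)) :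
    hexThetaSq ∣[(2 : ℤ)] γ = hexThetaOrbit (γ 1 0 : ℤ) (γ 1 1 : ℤ) := by
  have hmem : γ ∈ Subgroup.closure {ModularGroup.S, ModularGroup.T} := by
    simp [SpecialLinearGroup.SL2Z_generators]
  have key : ∀ x ∈ ({ModularGroup.S, ModularGroup.T} : Set SL(2, ℤ)), ∀ y : SL(2, ℤ),
      hexThetaOrbit (y 1 0 : ℤ) (y 1 1 : ℤ) ∣[(2 : ℤ)] x =
        hexThetaOrbit ((y * x) 1 0 : ℤ) ((y * x) 1 1 : ℤ) := by
    rintro x (rfl | rfl) y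
    · rw [hexThetaOrbit_slash_S]
      · simp [Matrix.SpecialLinearGroup.coe_mul, Matrix.mul_apply, Fin.sum_univ_two,
          ModularGroup.coe_S]
      · have h := congrArg (Int.cast : ℤ → ZMod 3) (SL_det y)
        push_cast at h
        by_contra! h'
        simp [h'.1, h'.2] at h
    · rw [hexThetaOrbit_slash_T]
      simp [Matrix.SpecialLinearGroup.coe_mul, Matrix.mul_apply, Fin.sum_univ_two,
          ModularGroup.coe_T]
  induction hmem using Subgroup.closure_induction_right with
  | one => simp [hexThetaOrbit]
  | mul_right x hx y hy ih => rw [SlashAction.slash_mul, ih, key y hy]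
  | mul_inv_cancel x hx y hy ih =>
    have h := key y hy (x * y⁻¹)
    rw [inv_mul_cancel_right] at h
    rw [SlashAction.slash_mul, ih, ← h, ← SlashAction.slash_mul, mul_inv_cancel,
      SlashAction.slash_one]

theorem isModForm_hexThetaSq : IsModForm (Gamma0 3) 2 hexThetaSq := by
  refine ⟨hasQExp_hexThetaSq.mdifferentiable, fun γ hγ ↦ ?_, fun γ ↦ ?_⟩
  · rw [CongruenceSubgroup.Gamma0_mem] at hγ
    rw [hexThetaSq_slash, hγ, hexThetaOrbit, if_pos rfl]
  · rw [hexThetaSq_slash, hexThetaOrbit]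
    split_ifs with h
    · exact hasQExp_hexThetaSq.isBoundedAtImInfty
    · exact (hasQExp_hexThetaSq.isBoundedAtImInfty.comp_tendsto
        (tendsto_affineMap 1 3 _)).const_smul_left _

/-! ### The Eisenstein series `E₄` and the octonary theta function -/

/-- The power series `∑ σ₃(n) Xⁿ`. -/
noncomputable def sigmaSeries : PowerSeries ℂ := .mk sigma3

theorem hasQExp_E₄ : HasQExp ModularForm.E₄ (1 + PowerSeries.C 240 * sigmaSeries) := by
  have h : (1 + PowerSeries.C 240 * sigmaSeries) = qExpansion 1 ModularForm.E₄ := by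
    ext n
    rw [EisensteinSeries.E_qExpansion_coeff _ ⟨2, rfl⟩,
      show bernoulli 4 = -1 / 30 by decide +kernel]
    -- The convention `σ₃(0) = 0` gives `sigmaSeries` no constant term. For `n > 0` the factor is
    -- `-8 / B₄ = 240`.
    by_cases hn : n = 0
    · simp [hn, sigmaSeries, sigma3]
    · norm_num [hn, sigmaSeries, sigma3, PowerSeries.coeff_one]
  rw [h]
  exact fun τ ↦ ModularForm.hasSum_qExpansion ModularForm.E₄ one_pos one_mem_strictPeriods_SL τ

theorem isModForm_E₄ : IsModForm (Gamma0 1) 4 ModularForm.E₄ := by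
  have h (γ : SL(2, ℤ)) : ⇑ModularForm.E₄ ∣[(4 : ℤ)] γ = ⇑ModularForm.E₄ :=
    SlashInvariantForm.slash_action_eqn ModularForm.E₄ _ ⟨γ, rfl⟩
  exact ⟨ModularForm.E₄.holo', fun γ _ ↦ h γ, fun γ ↦ by
    rw [h]; exact hasQExp_E₄.isBoundedAtImInfty⟩

/-- The theta function of the form represented by `repNumber 14`. -/
noncomputable def octTheta (z : ℍ) : ℂ := hexThetaSq z * hexThetaSq (scale 14 z)

theorem isModForm_octTheta : IsModForm (Gamma0 42) 4 octTheta := by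
  have h : Gamma0 42 ≤ Gamma0 3 := fun γ hγ ↦ by
    rw [CongruenceSubgroup.Gamma0_mem, ZMod.intCast_zmod_eq_zero_iff_dvd] at *
    exact dvd_trans (by norm_num) hγ
  exact (isModForm_hexThetaSq.mono h).mul (isModForm_hexThetaSq.scale (δ := 14) (by norm_num))

/-- Coordinates on `ℤ⁸` grouped in pairs. -/
def octEquiv : (Fin 8 → ℤ) ≃ ((ℤ × ℤ) × (ℤ × ℤ)) × ((ℤ × ℤ) × (ℤ × ℤ)) where
  toFun x := (((x 0, x 1), (x 2, x 3)), ((x 4, x 5), (x 6, x 7)))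
  invFun v := ![v.1.1.1, v.1.1.2, v.1.2.1, v.1.2.2, v.2.1.1, v.2.1.2, v.2.2.1, v.2.2.2]
  left_inv x := by ext i; fin_cases i <;> rfl
  right_inv v := rfl

theorem octEquiv_apply (x : Fin 8 → ℤ) :
    octEquiv x = (((x 0, x 1), (x 2, x 3)), ((x 4, x 5), (x 6, x 7))) := rfl

/-- The form `Q(v₁) + Q(v₂) + 14 (Q(v₃) + Q(v₄))`, where `Q(x, y) = x² + xy + y²`. -/
def octForm (v : ((ℤ × ℤ) × (ℤ × ℤ)) × ((ℤ × ℤ) × (ℤ × ℤ))) : ℕ :=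
  hexForm v.1.1 + hexForm v.1.2 + 14 * (hexForm v.2.1 + hexForm v.2.2)

theorem repNumber_eq_card (n : ℕ) : repNumber 14 n = Nat.card {v // octForm v = n} := by
  rw [repNumber, ← Nat.card_coe_set_eq]
  refine Nat.card_congr (octEquiv.subtypeEquiv fun x ↦ ?_)
  rw [Set.mem_ofPred_eq, ← Int.natCast_inj, octForm]
  push_cast
  simp only [coe_hexForm, octEquiv_apply]
  constructor <;> intro h <;> linarith

theorem hasSum_mul_prod {ι κ : Type*} {f : ι → ℂ} {g : κ → ℂ} {s t : ℂ} (hf : HasSum f s)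
    (hg : HasSum g t) (hf' : Summable fun i ↦ ‖f i‖) (hg' : Summable fun i ↦ ‖g i‖) :
    HasSum (fun v : ι × κ ↦ f v.1 * g v.2) (s * t) :=
  hf.mul hg (summable_mul_of_summable_norm hf' hg')

theorem hasSum_octTheta (τ : ℍ) :
    HasSum (fun v ↦ Periodic.qParam 1 (τ : ℂ) ^ octForm v) (octTheta τ) := by
  have hs := summable_norm_hexForm
  have hsq (z : ℍ) : HasSum (fun v : (ℤ × ℤ) × (ℤ × ℤ) ↦
      Periodic.qParam 1 (z : ℂ) ^ hexForm v.1 * Periodic.qParam 1 (z : ℂ) ^ hexForm v.2)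
      (hexThetaSq z) := by
    rw [hexThetaSq, sq]
    have h := hasSum_mul_prod (hasSum_hexTheta z) (hasSum_hexTheta z) (hs z) (hs z)
    exact h
  have hn (z : ℍ) : Summable fun v : (ℤ × ℤ) × (ℤ × ℤ) ↦
      ‖Periodic.qParam 1 (z : ℂ) ^ hexForm v.1 * Periodic.qParam 1 (z : ℂ) ^ hexForm v.2‖ :=
    by have h := (hs z).mul_norm (hs z); exact h
  have h := hasSum_mul_prod (hsq τ) (hsq (scale 14 τ)) (hn τ) (hn (scale 14 τ))
  have hterm (v : ((ℤ × ℤ) × (ℤ × ℤ)) × ((ℤ × ℤ) × (ℤ × ℤ))) :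
      Periodic.qParam 1 (τ : ℂ) ^ octForm v =
      Periodic.qParam 1 (τ : ℂ) ^ hexForm v.1.1 * Periodic.qParam 1 (τ : ℂ) ^ hexForm v.1.2 *
      (Periodic.qParam 1 (scale 14 τ : ℂ) ^ hexForm v.2.1 *
        Periodic.qParam 1 (scale 14 τ : ℂ) ^ hexForm v.2.2) := by
    rw [coe_scale, qParam_natMul, octForm]
    ring
  rw [funext hterm]
  exact h

theorem hasQExp_octTheta : HasQExp octTheta (.mk fun n ↦ (repNumber 14 n : ℂ)) := by
  simp only [repNumber_eq_card]
  exact hasQExp_of_hasSum hasSum_octTheta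

/-! ### Kronecker substitution for integer polynomials -/

/-- Kronecker substitution: an integer polynomial with coefficients smaller than `B` is divisible
by `X ^ N` as soon as its value at `B` is divisible by `B ^ N`. -/
theorem coeff_eq_zero_of_dvd_eval {B : ℤ} {N : ℕ} {p : Polynomial ℤ}
    (hp : ∀ n, |p.coeff n| < B) (h : B ^ N ∣ p.eval B) : ∀ n < N, p.coeff n = 0 := by
  induction N generalizing p with
  | zero => simp
  | succ N ih =>
    have hB : 0 < B := (abs_nonneg _).trans_lt (hp 0)
    have h1 : p.eval B = p.divX.eval B * B + p.coeff 0 := by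
      conv_lhs => rw [← p.divX_mul_X_add]
      simp
    have h2 : p.coeff 0 = 0 := by
      refine Int.eq_zero_of_abs_lt_dvd ?_ (hp 0)
      have h3 : B ∣ p.eval B := (dvd_pow_self B N.succ_ne_zero).trans h
      rw [h1] at h3
      exact (dvd_add_right (dvd_mul_left _ _)).mp h3
    rw [h1, h2, add_zero, pow_succ] at h
    have h4 := ih (p := p.divX) (fun n ↦ by simpa [Polynomial.coeff_divX] using hp (n + 1))
      ((mul_dvd_mul_iff_right hB.ne').mp h)
    intro n hn
    cases n with
    | zero => exact h2
    | succ n => simpa [Polynomial.coeff_divX] using h4 n (by omega)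

/-- Expressions for integer polynomials; a leaf is a list of pairs (coefficient, exponent). -/
inductive PolyExpr
  | leaf (l : List (ℤ × ℕ))
  | add (a b : PolyExpr)
  | mul (a b : PolyExpr)
  | pow (a : PolyExpr) (n : ℕ)

namespace PolyExpr

/-- The polynomial denoted by an expression. -/
noncomputable def denote : PolyExpr → Polynomial ℤ
  | leaf l => (l.map fun t ↦ Polynomial.C t.1 * Polynomial.X ^ t.2).sum
  | add a b => a.denote + b.denote
  | mul a b => a.denote * b.denote
  | pow a n => a.denote ^ n

/-- The value of an expression at a natural number. -/
def valueAt (B : ℕ) : PolyExpr → ℤ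
  | leaf l => (l.map fun t ↦ t.1 * ((B ^ t.2 : ℕ) : ℤ)).sum
  | add a b => a.valueAt B + b.valueAt B
  | mul a b => a.valueAt B * b.valueAt B
  | pow a n => a.valueAt B ^ n

/-- The expression with all coefficients replaced by their absolute values. -/
def abs : PolyExpr → PolyExpr
  | leaf l => leaf (l.map fun t ↦ (|t.1|, t.2))
  | add a b => add a.abs b.abs
  | mul a b => mul a.abs b.abs
  | pow a n => pow a.abs n

theorem eval_denote (B : ℕ) (e : PolyExpr) : e.denote.eval (B : ℤ) = e.valueAt B := by
  induction e with
  | leaf l =>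
    rw [denote, valueAt, ← Polynomial.coe_evalRingHom, map_list_sum, List.map_map]
    congr 1
    exact List.map_congr_left fun t _ ↦ by simp
  | add a b iha ihb => simp [denote, valueAt, iha, ihb]
  | mul a b iha ihb => simp [denote, valueAt, iha, ihb]
  | pow a n ih => simp [denote, valueAt, ih]

theorem abs_coeff_mul_le {p q p' q' : Polynomial ℤ} (hp : ∀ n, |p.coeff n| ≤ p'.coeff n)
    (hq : ∀ n, |q.coeff n| ≤ q'.coeff n) (n : ℕ) : |(p * q).coeff n| ≤ (p' * q').coeff n := by
  rw [Polynomial.coeff_mul, Polynomial.coeff_mul]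
  refine (Finset.abs_sum_le_sum_abs _ _).trans (Finset.sum_le_sum fun x _ ↦ ?_)
  rw [abs_mul]
  exact mul_le_mul (hp _) (hq _) (abs_nonneg _) ((abs_nonneg _).trans (hp _))

theorem abs_coeff_denote_le (e : PolyExpr) (n : ℕ) : |e.denote.coeff n| ≤ e.abs.denote.coeff n := by
  induction e generalizing n with
  | leaf l =>
    induction l with
    | nil => simp [denote, abs]
    | cons t l ih =>
      simp only [denote, abs, List.map_cons, List.sum_cons, Polynomial.coeff_add] at ih ⊢
      refine (abs_add_le _ _).trans (add_le_add ?_ ih)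
      rw [Polynomial.coeff_C_mul, Polynomial.coeff_C_mul, Polynomial.coeff_X_pow, abs_mul]
      split_ifs <;> simp
  | add a b iha ihb =>
    simp only [denote, abs, Polynomial.coeff_add]
    exact (abs_add_le _ _).trans (add_le_add (iha n) (ihb n))
  | mul a b iha ihb => exact abs_coeff_mul_le iha ihb n
  | pow a m ih =>
    simp only [denote, abs]
    induction m generalizing n with
    | zero =>
      rw [pow_zero, pow_zero, Polynomial.coeff_one]
      split_ifs <;> simp
    | succ m ihm =>
      rw [pow_succ, pow_succ]
      exact abs_coeff_mul_le ihm ih n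

/-- A coefficient is at most the sum of all coefficients of the dominating polynomial, that is, its
value at 1. This bound is computed without expanding any product. -/
theorem abs_coeff_denote_le_valueAt_one (e : PolyExpr) (n : ℕ) :
    |e.denote.coeff n| ≤ e.abs.valueAt 1 := by
  refine (e.abs_coeff_denote_le n).trans ?_
  have h0 (m : ℕ) : 0 ≤ e.abs.denote.coeff m := (abs_nonneg _).trans (e.abs_coeff_denote_le m)
  rw [← eval_denote, Nat.cast_one, Polynomial.eval_eq_sum_range]
  simp only [one_pow, mul_one]
  by_cases hn : n ∈ Finset.range (e.abs.denote.natDegree + 1)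
  · exact Finset.single_le_sum (f := fun i ↦ e.abs.denote.coeff i) (fun i _ ↦ h0 i) hn
  · rw [Polynomial.coeff_eq_zero_of_natDegree_lt (by simpa using hn)]
    exact Finset.sum_nonneg fun i _ ↦ h0 i

theorem coeff_denote_eq_zero {e : PolyExpr} {N B : ℕ} (hB : e.abs.valueAt 1 < B)
    (h : e.valueAt B % ((B ^ N : ℕ) : ℤ) = 0) : ∀ n < N, e.denote.coeff n = 0 := by
  refine coeff_eq_zero_of_dvd_eval (B := B)
    (fun n ↦ (e.abs_coeff_denote_le_valueAt_one n).trans_lt hB) ?_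
  rw [eval_denote]
  exact_mod_cast Int.dvd_of_emod_eq_zero h

end PolyExpr

/-! ### Truncated expansions to order 129 -/

/-- `f` has a `q`-expansion agreeing with the polynomial `e` in degrees less than `N`. -/
def ApproxBy (N : ℕ) (f : ℍ → ℂ) (e : PolyExpr) : Prop :=
  ∃ p, HasQExp f p ∧ ∀ n < N, p.coeff n = (e.denote.coeff n : ℂ)

namespace ApproxBy

variable {N : ℕ} {f g : ℍ → ℂ} {a b : PolyExpr}

theorem add (hf : ApproxBy N f a) (hg : ApproxBy N g b) :
    ApproxBy N (fun z ↦ f z + g z) (.add a b) := by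
  obtain ⟨p, hp, hp'⟩ := hf
  obtain ⟨r, hr, hr'⟩ := hg
  exact ⟨_, hp.add hr, fun n hn ↦ by simp [PolyExpr.denote, hp' n hn, hr' n hn]⟩

theorem mul (hf : ApproxBy N f a) (hg : ApproxBy N g b) :
    ApproxBy N (fun z ↦ f z * g z) (.mul a b) := by
  obtain ⟨p, hp, hp'⟩ := hf
  obtain ⟨r, hr, hr'⟩ := hg
  refine ⟨_, hp.mul hr, fun n hn ↦ ?_⟩
  rw [PowerSeries.coeff_mul, PolyExpr.denote, Polynomial.coeff_mul]
  push_cast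
  refine Finset.sum_congr rfl fun x hx ↦ ?_
  have h := Finset.HasAntidiagonal.mem_antidiagonal.mp hx
  rw [hp' _ (by omega), hr' _ (by omega)]

theorem congr (hf : ApproxBy N f a) (h : ∀ z, f z = g z) : ApproxBy N g a := by
  rwa [← funext h]

theorem pow (hf : ApproxBy N f a) (n : ℕ) : ApproxBy N (fun z ↦ f z ^ n) (.pow a n) := by
  induction n with
  | zero =>
    refine ⟨1, by simpa using HasQExp.one, fun n hn ↦ ?_⟩
    simp only [PolyExpr.denote, pow_zero, PowerSeries.coeff_one, Polynomial.coeff_one]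
    split_ifs <;> simp
  | succ n ih =>
    obtain ⟨p, hp, hp'⟩ := ih.mul hf
    exact ⟨p, hp.congr fun z ↦ (pow_succ _ _).symm, fun m hm ↦ by
      rw [hp' m hm]; simp [PolyExpr.denote, pow_succ]⟩

end ApproxBy

theorem coeff_denote_leaf (l : List (ℤ × ℕ)) (n : ℕ) :
    (PolyExpr.leaf l).denote.coeff n = (l.map fun t ↦ if n = t.2 then t.1 else 0).sum := by
  rw [PolyExpr.denote]
  induction l with
  | nil => simp
  | cons t l ih =>
    rw [List.map_cons, List.map_cons, List.sum_cons, List.sum_cons, Polynomial.coeff_add, ih,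
      Polynomial.coeff_C_mul, Polynomial.coeff_X_pow]
    simp

theorem approxBy_monomial (N : ℕ) (c : ℤ) (k : ℕ) :
    ApproxBy N (fun z ↦ c * Periodic.qParam 1 (z : ℂ) ^ k) (.leaf [(c, k)]) :=
  ⟨_, (HasQExp.qParam_pow k).const_mul c, fun n _ ↦ by
    rw [coeff_denote_leaf, PowerSeries.coeff_C_mul, PowerSeries.coeff_X_pow]
    simp⟩

/-- The list of terms of degree less than `N` of `p(X ^ t)`. -/
def dilateLeaf (N t : ℕ) (l : List (ℤ × ℕ)) : List (ℤ × ℕ) :=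
  (l.map fun s ↦ (s.1, t * s.2)).filter fun s ↦ s.2 < N

theorem coeff_denote_filter {N n : ℕ} (hn : n < N) (l : List (ℤ × ℕ)) :
    (PolyExpr.leaf (l.filter fun s ↦ s.2 < N)).denote.coeff n =
      (PolyExpr.leaf l).denote.coeff n := by
  rw [coeff_denote_leaf, coeff_denote_leaf]
  induction l with
  | nil => simp
  | cons t l ih =>
    by_cases h : t.2 < N
    · simp [h, ih]
    · rw [List.filter_cons_of_neg (by simpa using h), ih, List.map_cons, List.sum_cons,
        if_neg (by omega), zero_add]

theorem ApproxBy.scale {N : ℕ} {f : ℍ → ℂ} {l : List (ℤ × ℕ)} (hf : ApproxBy N f (.leaf l))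
    (t : ℕ) [NeZero t] : ApproxBy N (fun z ↦ f (scale t z)) (.leaf (dilateLeaf N t l)) := by
  obtain ⟨p, hp, hp'⟩ := hf
  refine ⟨_, hp.scale t, fun n hn ↦ ?_⟩
  rw [dilateLeaf, coeff_denote_filter hn, coeff_denote_leaf, List.map_map, dilate,
    PowerSeries.coeff_mk, atQuot]
  split_ifs with h
  · obtain ⟨m, rfl⟩ := h
    have hm : m < N := (Nat.le_mul_of_pos_left m (NeZero.pos t)).trans_lt hn
    rw [Nat.mul_div_cancel_left m (NeZero.pos t), hp' m hm, coeff_denote_leaf]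
    simp [Function.comp_def, NeZero.ne t]
  · have h0 : ∀ x ∈ l.map ((fun s : ℤ × ℕ ↦ if n = s.2 then s.1 else 0) ∘ fun s ↦ (s.1, t * s.2)),
        x = 0 := by
      simp only [List.mem_map, comp_apply, forall_exists_index, and_imp]
      rintro x s - rfl
      exact if_neg fun hn ↦ h ⟨_, hn⟩
    rw [List.sum_eq_zero h0, Int.cast_zero]

/-- The terms of degree less than `129` of the Euler product. -/
def eulerLeaf : List (ℤ × ℕ) :=
  (List.range 19).map fun i : ℕ ↦ (-(-1) ^ i, pentagonal ((i : ℤ) - 9))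

theorem approxBy_eulerProd : ApproxBy 129 eulerProd (.leaf eulerLeaf) := by
  refine ⟨_, hasQExp_eulerProd, fun n hn ↦ ?_⟩
  rw [coeff_denote_leaf]
  by_cases h : n ∈ Set.range pentagonal
  · obtain ⟨k, rfl⟩ := h
    rw [PowerSeries.coeff_pentagonalSeries_pentagonal]
    have hk := two_mul_natCast_pentagonal k
    -- The next pentagonal numbers, at `k = 10` and `k = -10`, are 145 and 155, both beyond the
    -- truncation at 129.
    have hk1 : -9 ≤ k := by by_contra! h; nlinarith
    have hk2 : k ≤ 9 := by by_contra! h; nlinarith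
    have key : ∀ k ∈ Finset.Icc (-9 : ℤ) 9, (k.negOnePow : ℤ) =
        (eulerLeaf.map fun t ↦ if pentagonal k = t.2 then t.1 else 0).sum := by decide +kernel
    rw [← key k (Finset.mem_Icc.mpr ⟨hk1, hk2⟩)]
  · rw [PowerSeries.coeff_pentagonalSeries_eq_zero ℂ h, List.sum_eq_zero, Int.cast_zero]
    simp only [eulerLeaf, List.map_map, List.mem_map, forall_exists_index, and_imp, comp_apply]
    rintro x i - rfl
    exact if_neg fun hn ↦ h ⟨_, hn.symm⟩

/-- The integer points with coordinates at most `13` in absolute value. -/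
def hexBox : List (ℤ × ℤ) :=
  ((List.range 27).map fun i : ℕ ↦ (i : ℤ) - 13) ×ˢ ((List.range 27).map fun i : ℕ ↦ (i : ℤ) - 13)

theorem nodup_hexBox : hexBox.Nodup := by
  have h : ((List.range 27).map fun i : ℕ ↦ (i : ℤ) - 13).Nodup := by decide
  exact h.product h

theorem mem_hexBox {v : ℤ × ℤ} (h : hexForm v < 129) : v ∈ hexBox := by
  have hv : (hexForm v : ℤ) < 129 := by exact_mod_cast h
  rw [coe_hexForm] at hv
  have key (x y : ℤ) (hxy : x ^ 2 + x * y + y ^ 2 < 129) :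
      x ∈ (List.range 27).map fun i : ℕ ↦ (i : ℤ) - 13 := by
    -- From `4(x² + xy + y²) = 3x² + (x + 2y)²` one gets `3x² < 516`, so `|x| ≤ 13`.
    have h1 : -13 ≤ x := by by_contra! h; nlinarith [sq_nonneg (x + 2 * y)]
    have h2 : x ≤ 13 := by by_contra! h; nlinarith [sq_nonneg (x + 2 * y)]
    simp only [List.mem_map, List.mem_range]
    exact ⟨(x + 13).toNat, by omega, by omega⟩
  exact List.mem_product.mpr ⟨key _ _ hv, key v.2 v.1 (by linarith)⟩

/-- The terms of `hexTheta` of degree less than `129`. -/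
def hexLeaf : List (ℤ × ℕ) := (hexBox.map fun v ↦ ((1 : ℤ), hexForm v)).filter fun s ↦ s.2 < 129

theorem card_hexForm {n : ℕ} (hn : n < 129) :
    Nat.card {v // hexForm v = n} = (hexBox.filter fun v ↦ n = hexForm v).length := by
  rw [Nat.subtype_card (hexBox.filter fun v ↦ n = hexForm v).toFinset,
    List.toFinset_card_of_nodup (nodup_hexBox.filter _)]
  intro v
  simp only [List.mem_toFinset, List.mem_filter, decide_eq_true_eq]
  exact ⟨fun h ↦ h.2.symm, fun h ↦ ⟨mem_hexBox (h ▸ hn), h.symm⟩⟩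

theorem sum_map_ite_eq_length {α : Type*} (l : List α) (p : α → Prop) [DecidablePred p] :
    (l.map fun a ↦ if p a then (1 : ℤ) else 0).sum = (l.filter p).length := by
  induction l with
  | nil => simp
  | cons a l ih =>
    by_cases h : p a
    · simp [h, ih]; ring
    · simp [h, ih]

theorem approxBy_hexTheta : ApproxBy 129 hexTheta (.leaf hexLeaf) := by
  refine ⟨_, hasQExp_hexTheta, fun n hn ↦ ?_⟩
  rw [hexLeaf, coeff_denote_filter hn, coeff_denote_leaf, PowerSeries.coeff_mk, card_hexForm hn,
    List.map_map, ← Int.cast_natCast, ← sum_map_ite_eq_length]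
  rfl

/-- `∑ σ₃(n) qⁿ`. -/
noncomputable def sigmaFun (z : ℍ) : ℂ := (ModularForm.E₄ z - 1) / 240

theorem hasQExp_sigmaFun : HasQExp sigmaFun sigmaSeries := by
  have h := ((hasQExp_E₄.sub HasQExp.one).const_mul (1 / 240))
  have h1 : PowerSeries.C (1 / 240 : ℂ) * (1 + PowerSeries.C 240 * sigmaSeries - 1) =
      sigmaSeries := by
    rw [add_sub_cancel_left, ← mul_assoc, ← map_mul]
    norm_num
  rw [h1] at h
  exact h.congr fun z ↦ by rw [sigmaFun]; ring

/-- The terms of degree less than `129` of `∑ σ₃(n) Xⁿ`. -/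
def sigmaLeaf : List (ℤ × ℕ) :=
  (List.range 129).map fun n ↦ ((ArithmeticFunction.sigma 3 n : ℕ), n)

theorem approxBy_sigmaFun : ApproxBy 129 sigmaFun (.leaf sigmaLeaf) := by
  refine ⟨_, hasQExp_sigmaFun, fun n hn ↦ ?_⟩
  have h : ((sigmaLeaf.map fun t ↦ if n = t.2 then t.1 else 0).sum) =
      ∑ m ∈ Finset.range 129, if n = m then ((ArithmeticFunction.sigma 3 m : ℕ) : ℤ) else 0 := by
    rw [sigmaLeaf, List.map_map]; rfl
  rw [coeff_denote_leaf, h, Finset.sum_ite_eq, if_pos (Finset.mem_range.mpr hn), sigmaSeries,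
    PowerSeries.coeff_mk, sigma3, Int.cast_natCast]

/-- `c qᵐ ∏_δ E(q^δ) ^ a_δ`, where `E` is the Euler product and `δ` runs over the divisors of
`42`. -/
noncomputable def eulerMonomial (c : ℤ) (m a₁ a₂ a₃ a₆ a₇ a₁₄ a₂₁ a₄₂ : ℕ) (z : ℍ) : ℂ :=
  c * Periodic.qParam 1 (z : ℂ) ^ m *
    (eulerProd (scale 1 z) ^ a₁ * (eulerProd (scale 2 z) ^ a₂ * (eulerProd (scale 3 z) ^ a₃ *
    (eulerProd (scale 6 z) ^ a₆ * (eulerProd (scale 7 z) ^ a₇ * (eulerProd (scale 14 z) ^ a₁₄ *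
    (eulerProd (scale 21 z) ^ a₂₁ * eulerProd (scale 42 z) ^ a₄₂)))))))

/-- The truncation of `eulerMonomial`. -/
def eulerMonomialExpr (c : ℤ) (m a₁ a₂ a₃ a₆ a₇ a₁₄ a₂₁ a₄₂ : ℕ) : PolyExpr :=
  let E (δ a : ℕ) : PolyExpr := .pow (.leaf (dilateLeaf 129 δ eulerLeaf)) a
  .mul (.leaf [(c, m)]) (.mul (E 1 a₁) (.mul (E 2 a₂) (.mul (E 3 a₃) (.mul (E 6 a₆)
    (.mul (E 7 a₇) (.mul (E 14 a₁₄) (.mul (E 21 a₂₁) (E 42 a₄₂))))))))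

theorem approxBy_eulerMonomial (c : ℤ) (m a₁ a₂ a₃ a₆ a₇ a₁₄ a₂₁ a₄₂ : ℕ) :
    ApproxBy 129 (eulerMonomial c m a₁ a₂ a₃ a₆ a₇ a₁₄ a₂₁ a₄₂)
      (eulerMonomialExpr c m a₁ a₂ a₃ a₆ a₇ a₁₄ a₂₁ a₄₂) := by
  have h (δ : ℕ) [NeZero δ] (a : ℕ) := (approxBy_eulerProd.scale δ).pow a
  exact (approxBy_monomial 129 c m).mul ((h 1 a₁).mul ((h 2 a₂).mul ((h 3 a₃).mul ((h 6 a₆).mul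
    ((h 7 a₇).mul ((h 14 a₁₄).mul ((h 21 a₂₁).mul (h 42 a₄₂))))))))

/-- The common denominator `∏_δ E(q^δ)²`. -/
noncomputable def eulerDenom : ℍ → ℂ := eulerMonomial 1 0 2 2 2 2 2 2 2 2
-- The only denominators are squares of eta functions, and those of `C₃`, `C₄`, `C₁₇` and `C₃(3z)`
-- together involve each divisor of 42 once. Multiplying by every `E(q^δ)²` therefore leaves only
-- nonnegative exponents.
theorem etaC2_mul_eulerDenom (z : ℍ) :
    etaC2 z * eulerDenom z = eulerMonomial 1 2 4 4 2 2 4 4 2 2 z := by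
  simp only [etaC2, eulerDenom, eulerMonomial, etaAt_eq, ← qParam_24_pow]
  ring

theorem etaC3_mul_eulerDenom (z : ℍ) :
    etaC3 z * eulerDenom z = eulerMonomial 1 3 8 0 2 2 0 8 2 2 z := by
  have h2 := eulerProd_ne_zero (scale 2 z)
  have h7 := eulerProd_ne_zero (scale 7 z)
  have hq := Periodic.qParam_ne_zero (h := 24) (z : ℂ)
  simp only [etaC3, eulerDenom, eulerMonomial, etaAt_eq, ← qParam_24_pow]
  field_simp

theorem etaC4_mul_eulerDenom (z : ℍ) :
    etaC4 z * eulerDenom z = eulerMonomial 1 1 0 8 2 2 8 0 2 2 z := by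
  have h1 := eulerProd_ne_zero (scale 1 z)
  have h14 := eulerProd_ne_zero (scale 14 z)
  have hq := Periodic.qParam_ne_zero (h := 24) (z : ℂ)
  simp only [etaC4, eulerDenom, eulerMonomial, etaAt_eq, ← qParam_24_pow]
  field_simp

theorem etaC3_scale_mul_eulerDenom (z : ℍ) :
    etaC3 (scale 3 z) * eulerDenom z = eulerMonomial 1 9 2 2 8 0 2 2 0 8 z := by
  have h6 := eulerProd_ne_zero (scale 6 z)
  have h21 := eulerProd_ne_zero (scale 21 z)
  have hq := Periodic.qParam_ne_zero (h := 24) (z : ℂ)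
  simp only [etaC3, etaAt_scale, Nat.reduceMul]
  simp only [eulerDenom, eulerMonomial, etaAt_eq, ← qParam_24_pow]
  field_simp

theorem etaC5_mul_eulerDenom (z : ℍ) :
    etaC5 z * eulerDenom z = eulerMonomial 1 1 4 4 4 4 2 2 2 2 z := by
  simp only [etaC5, eulerDenom, eulerMonomial, etaAt_eq, ← qParam_24_pow]
  ring

theorem etaC6_mul_eulerDenom (z : ℍ) :
    etaC6 z * eulerDenom z = eulerMonomial 1 6 2 3 5 2 3 2 2 5 z := by
  simp only [etaC6, eulerDenom, eulerMonomial, etaAt_eq, ← qParam_24_pow]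
  ring

theorem etaC7_mul_eulerDenom (z : ℍ) :
    etaC7 z * eulerDenom z = eulerMonomial 1 4 3 2 2 5 2 3 5 2 z := by
  simp only [etaC7, eulerDenom, eulerMonomial, etaAt_eq, ← qParam_24_pow]
  ring

theorem etaC8_mul_eulerDenom (z : ℍ) :
    etaC8 z * eulerDenom z = eulerMonomial 1 7 2 2 2 2 4 4 4 4 z := by
  simp only [etaC8, eulerDenom, eulerMonomial, etaAt_eq, ← qParam_24_pow]
  ring

theorem etaC10_mul_eulerDenom (z : ℍ) :
    etaC10 z * eulerDenom z = eulerMonomial 1 3 2 4 2 4 4 2 4 2 z := by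
  simp only [etaC10, eulerDenom, eulerMonomial, etaAt_eq, ← qParam_24_pow]
  ring

theorem etaC12_mul_eulerDenom (z : ℍ) :
    etaC12 z * eulerDenom z = eulerMonomial 1 3 5 2 2 3 2 5 3 2 z := by
  simp only [etaC12, eulerDenom, eulerMonomial, etaAt_eq, ← qParam_24_pow]
  ring

theorem etaC17_mul_eulerDenom (z : ℍ) :
    etaC17 z * eulerDenom z = eulerMonomial 1 3 2 2 0 8 2 2 8 0 z := by
  have h3 := eulerProd_ne_zero (scale 3 z)
  have h42 := eulerProd_ne_zero (scale 42 z)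
  have hq := Periodic.qParam_ne_zero (h := 24) (z : ℂ)
  simp only [etaC17, eulerDenom, eulerMonomial, etaAt_eq, ← qParam_24_pow]
  field_simp

theorem etaC19_mul_eulerDenom (z : ℍ) :
    etaC19 z * eulerDenom z = eulerMonomial 1 6 2 2 4 4 2 2 4 4 z := by
  simp only [etaC19, eulerDenom, eulerMonomial, etaAt_eq, ← qParam_24_pow]
  ring

/-! ### Vanishing of the difference of the two sides -/

/-- The Eisenstein part `∑_{t ∣ 42} t² E₄(tz)`. -/
noncomputable def eisPart (z : ℍ) : ℂ :=
  ModularForm.E₄ (scale 1 z) + 4 * ModularForm.E₄ (scale 2 z) + 9 * ModularForm.E₄ (scale 3 z) +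
    36 * ModularForm.E₄ (scale 6 z) + 49 * ModularForm.E₄ (scale 7 z) +
    196 * ModularForm.E₄ (scale 14 z) + 441 * ModularForm.E₄ (scale 21 z) + 1764 * ModularForm.E₄ (scale 42 z)

/-- `875` times the difference of the two sides of the identity to be proved. -/
noncomputable def defect (z : ℍ) : ℂ :=
  875 * octTheta z - 7 / 20 * eisPart z - 10080 * etaC2 z + 210 * etaC3 z - 10290 * etaC4 z +
    1890 * etaC3 (scale 3 z) - 126 * etaC5 z + 113400 * etaC6 z - 86940 * etaC7 z - 6174 * etaC8 z +
    45360 * etaC10 z + 8820 * etaC12 z - 92610 * etaC17 z - 90720 * etaC19 z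

/-- The truncation of `defect * eulerDenom`. -/
def defectExpr : PolyExpr :=
  let S (t : ℕ) : PolyExpr := .mul (.leaf [(-84 * t ^ 2, 0)]) (.leaf (dilateLeaf 129 t sigmaLeaf))
  let A (t : ℕ) : PolyExpr := .pow (.leaf (dilateLeaf 129 t hexLeaf)) 2
  .add (.mul (eulerMonomialExpr 1 0 2 2 2 2 2 2 2 2)
    (.add (.mul (.leaf [(875, 0)]) (.mul (A 1) (A 14))) (.add (.leaf [(-875, 0)])
    (.add (S 1) (.add (S 2) (.add (S 3) (.add (S 6) (.add (S 7)
    (.add (S 14) (.add (S 21) (S 42)))))))))))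
    (.add (eulerMonomialExpr (-10080) 2 4 4 2 2 4 4 2 2)
    (.add (eulerMonomialExpr 210 3 8 0 2 2 0 8 2 2)
    (.add (eulerMonomialExpr (-10290) 1 0 8 2 2 8 0 2 2)
    (.add (eulerMonomialExpr 1890 9 2 2 8 0 2 2 0 8)
    (.add (eulerMonomialExpr (-126) 1 4 4 4 4 2 2 2 2)
    (.add (eulerMonomialExpr 113400 6 2 3 5 2 3 2 2 5)
    (.add (eulerMonomialExpr (-86940) 4 3 2 2 5 2 3 5 2)
    (.add (eulerMonomialExpr (-6174) 7 2 2 2 2 4 4 4 4)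
    (.add (eulerMonomialExpr 45360 3 2 4 2 4 4 2 4 2)
    (.add (eulerMonomialExpr 8820 3 5 2 2 3 2 5 3 2)
    (.add (eulerMonomialExpr (-92610) 3 2 2 0 8 2 2 8 0)
    (eulerMonomialExpr (-90720) 6 2 2 4 4 2 2 4 4))))))))))))

/-- The base `2 ^ 192` exceeds every coefficient in absolute value, as Kronecker substitution
requires. -/
theorem defectExpr_size : defectExpr.abs.valueAt 1 < ((2 ^ 192 : ℕ) : ℤ) := by decide +kernel

theorem defectExpr_valueAt : defectExpr.valueAt (2 ^ 192) % (((2 ^ 192) ^ 129 : ℕ) : ℤ) = 0 := by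
  decide +kernel

/-- With `E₄ = 1 + 240 ∑ σ₃(n) qⁿ`, the Eisenstein part contributes `-84 t²` times each dilated
sigma series, as `240 · 7/20 = 84`. Its constant is `-(7/20) · 2500 = -875`, since the `t²` over `t
∣ 42` sum to 2500. -/
theorem approxBy_defect_mul_eulerDenom :
    ApproxBy 129 (fun z ↦ defect z * eulerDenom z) defectExpr := by
  have hS (t : ℕ) [NeZero t] := (approxBy_monomial 129 (-84 * t ^ 2) 0).mul
    (approxBy_sigmaFun.scale t)
  have hA (t : ℕ) [NeZero t] := (approxBy_hexTheta.scale t).pow 2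
  have hM := approxBy_eulerMonomial
  refine (((hM 1 0 2 2 2 2 2 2 2 2).mul (((approxBy_monomial 129 875 0).mul
    ((hA 1).mul (hA 14))).add ((approxBy_monomial 129 (-875) 0).add ((hS 1).add ((hS 2).add
    ((hS 3).add ((hS 6).add ((hS 7).add ((hS 14).add ((hS 21).add (hS 42))))))))))).add
    ((hM (-10080) 2 4 4 2 2 4 4 2 2).add ((hM 210 3 8 0 2 2 0 8 2 2).add
    ((hM (-10290) 1 0 8 2 2 8 0 2 2).add ((hM 1890 9 2 2 8 0 2 2 0 8).add
    ((hM (-126) 1 4 4 4 4 2 2 2 2).add ((hM 113400 6 2 3 5 2 3 2 2 5).add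
    ((hM (-86940) 4 3 2 2 5 2 3 5 2).add ((hM (-6174) 7 2 2 2 2 4 4 4 4).add
    ((hM 45360 3 2 4 2 4 4 2 4 2).add ((hM 8820 3 5 2 2 3 2 5 3 2).add
    ((hM (-92610) 3 2 2 0 8 2 2 8 0).add (hM (-90720) 6 2 2 4 4 2 2 4 4))))))))))))).congr
    fun z ↦ ?_
  have hc (c : ℤ) (m a₁ a₂ a₃ a₆ a₇ a₁₄ a₂₁ a₄₂ : ℕ) :
      eulerMonomial c m a₁ a₂ a₃ a₆ a₇ a₁₄ a₂₁ a₄₂ z =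
        c * eulerMonomial 1 m a₁ a₂ a₃ a₆ a₇ a₁₄ a₂₁ a₄₂ z := by
    simp only [eulerMonomial, Int.cast_one]; ring
  rw [hc (-10080), hc 210, hc (-10290), hc 1890, hc (-126), hc 113400, hc (-86940), hc (-6174),
    hc 45360, hc 8820, hc (-92610), hc (-90720), ← etaC2_mul_eulerDenom, ← etaC3_mul_eulerDenom,
    ← etaC4_mul_eulerDenom, ← etaC3_scale_mul_eulerDenom, ← etaC5_mul_eulerDenom,
    ← etaC6_mul_eulerDenom, ← etaC7_mul_eulerDenom, ← etaC8_mul_eulerDenom,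
    ← etaC10_mul_eulerDenom, ← etaC12_mul_eulerDenom, ← etaC17_mul_eulerDenom,
    ← etaC19_mul_eulerDenom]
  have h1 : scale 1 z = z := by ext; simp
  have h2 : eulerMonomial 1 0 2 2 2 2 2 2 2 2 z = eulerDenom z := rfl
  simp only [h1, h2, defect, eisPart, octTheta, hexThetaSq, sigmaFun, pow_zero, mul_one]
  push_cast
  ring

theorem isModForm_E₄_scale {t : ℕ} [NeZero t] (ht : t ∣ 42) :
    IsModForm levelGroup 4 fun z ↦ ModularForm.E₄ (scale t z) :=
  (isModForm_E₄.scale (by simpa using ht)).mono levelGroup_le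

theorem isModForm_eisPart : IsModForm levelGroup 4 eisPart := by
  have h (t : ℕ) [NeZero t] (ht : t ∣ 42) (c : ℂ) := (isModForm_E₄_scale ht).const_smul c
  have h' := (((((((h 1 (by decide) 1).add (h 2 (by decide) 4)).add (h 3 (by decide) 9)).add
    (h 6 (by decide) 36)).add (h 7 (by decide) 49)).add (h 14 (by decide) 196)).add
    (h 21 (by decide) 441)).add (h 42 (by decide) 1764)
  convert h' using 1
  funext z
  simp [eisPart]

theorem isModForm_defect : IsModForm levelGroup 4 defect := by
  have h {f : ℍ → ℂ} (hf : IsModForm (Gamma0 42) 4 f) (c : ℂ) :=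
    (hf.mono levelGroup_le).const_smul c
  have h' := (((((((((((((h isModForm_octTheta 875).add
    (isModForm_eisPart.const_smul (-(7 / 20)))).add
    (h isModForm_etaC2 (-10080))).add (h isModForm_etaC3 210)).add
    (h isModForm_etaC4 (-10290))).add (h isModForm_etaC3_scale 1890)).add
    (h isModForm_etaC5 (-126))).add (isModForm_etaC6.const_smul 113400)).add
    (isModForm_etaC7.const_smul (-86940))).add (h isModForm_etaC8 (-6174))).add
    (h isModForm_etaC10 45360)).add (isModForm_etaC12.const_smul 8820)).add
    (h isModForm_etaC17 (-92610))).add (h isModForm_etaC19 (-90720))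
  convert h' using 1
  funext z
  simp only [defect, Pi.add_apply, Pi.smul_apply, smul_eq_mul]
  ring

theorem defect_eq_zero : defect = 0 := by
  have hD : ApproxBy 129 eulerDenom (eulerMonomialExpr 1 0 2 2 2 2 2 2 2 2) :=
    approxBy_eulerMonomial 1 0 2 2 2 2 2 2 2 2
  obtain ⟨d, hd, hd'⟩ := hD
  have hF := isModForm_defect.hasQExp T_mem_levelGroup
  obtain ⟨p, hp, hp'⟩ := approxBy_defect_mul_eulerDenom
  have hzero := PolyExpr.coeff_denote_eq_zero defectExpr_size defectExpr_valueAt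
  have hpd : PowerSeries.X ^ 129 ∣ qExpansion 1 defect * d := by
    rw [PowerSeries.X_pow_dvd_iff, (hF.mul hd).unique hp]
    intro n hn
    rw [hp' n hn, hzero n hn, Int.cast_zero]
  -- The constant term, read off by evaluating the truncation at 0, is 1. Vanishing to order 129
  -- thus passes from the product to `defect`.
  have hunit : IsUnit d := by
    rw [PowerSeries.isUnit_iff_constantCoeff, ← PowerSeries.coeff_zero_eq_constantCoeff_apply,
      hd' 0 (by norm_num), Polynomial.coeff_zero_eq_eval_zero]
    have h0 := PolyExpr.eval_denote 0 (eulerMonomialExpr 1 0 2 2 2 2 2 2 2 2)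
    rw [Nat.cast_zero] at h0
    have h1 : (eulerMonomialExpr 1 0 2 2 2 2 2 2 2 2).valueAt 0 = 1 := by decide +kernel
    rw [h0, h1]
    simp
  rw [hunit.dvd_mul_right, PowerSeries.X_pow_dvd_iff] at hpd
  -- The bound is `4 · 384 / 12 = 128`, one less than the number of coefficients checked.
  refine isModForm_defect.eq_zero_of_isBigO (k := 4) (N := 129) ?_
    (hF.isBigO_of_coeff_eq_zero hpd)
  have := index_levelGroup_le
  omega

/-! ### Comparison of coefficients -/

theorem hasQExp_of_isModForm_Gamma0 {f : ℍ → ℂ} (hf : IsModForm (Gamma0 42) 4 f) :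
    HasQExp f (qExpansion 1 f) :=
  (hf.mono levelGroup_le).hasQExp T_mem_levelGroup

theorem coeff_dilate (t n : ℕ) (p : PowerSeries ℂ) :
    (dilate t p).coeff n = atQuot (fun m ↦ p.coeff m) n t := PowerSeries.coeff_mk _ _

/-- Since `C₂(3z) = C₁₉(z)`, two terms of the formula are proportional and merge into one. The same
happens for `C₄(3z) = C₁₇(z)`. -/
theorem atQuot_c2 (n : ℕ) : atQuot c2 n 3 = c19 n := by
  have h := ((hasQExp_of_isModForm_Gamma0 isModForm_etaC2).scale 3).congr etaC2_scale
  rw [c19, fourierCoeffAt, ← h.unique (hasQExp_of_isModForm_Gamma0 isModForm_etaC19), coeff_dilate]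
  rfl

theorem atQuot_c4 (n : ℕ) : atQuot c4 n 3 = c17 n := by
  have h := ((hasQExp_of_isModForm_Gamma0 isModForm_etaC4).scale 3).congr etaC4_scale
  rw [c17, fourierCoeffAt, ← h.unique (hasQExp_of_isModForm_Gamma0 isModForm_etaC17), coeff_dilate]
  rfl

theorem hasQExp_sigmaFun_scale (t : ℕ) [NeZero t] :
    HasQExp (fun z ↦ sigmaFun (scale t z)) (dilate t sigmaSeries) := hasQExp_sigmaFun.scale t

theorem coeff_sigmaSeries : (fun m ↦ sigmaSeries.coeff m) = sigma3 :=
  funext fun _ ↦ PowerSeries.coeff_mk _ _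

theorem octTheta_eq (z : ℍ) : 875 * octTheta z = 875 * 1 + 84 * sigmaFun (scale 1 z) +
    336 * sigmaFun (scale 2 z) + 756 * sigmaFun (scale 3 z) + 3024 * sigmaFun (scale 6 z) +
    4116 * sigmaFun (scale 7 z) + 16464 * sigmaFun (scale 14 z) + 37044 * sigmaFun (scale 21 z) +
    148176 * sigmaFun (scale 42 z) + 10080 * etaC2 z + -210 * etaC3 z + 10290 * etaC4 z +
    -1890 * etaC3 (scale 3 z) + 126 * etaC5 z + -113400 * etaC6 z + 86940 * etaC7 z +
    6174 * etaC8 z + -45360 * etaC10 z + -8820 * etaC12 z + 92610 * etaC17 z +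
    90720 * etaC19 z := by
  have h := congrFun defect_eq_zero z
  simp only [defect, eisPart, Pi.zero_apply] at h
  simp only [sigmaFun]
  linear_combination h

end Level42

open Level42 in
theorem theorem8 (n : ℕ) (hn : 0 < n) :
    (repNumber 14 n : ℂ) =
      12 / 125 * sigma3 n + 48 / 125 * atQuot sigma3 n 2
      + 108 / 125 * atQuot sigma3 n 3 + 432 / 125 * atQuot sigma3 n 6
      + 588 / 125 * atQuot sigma3 n 7 + 2352 / 125 * atQuot sigma3 n 14
      + 5292 / 125 * atQuot sigma3 n 21 + 21168 / 125 * atQuot sigma3 n 42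
      + 288 / 25 * c2 n - 6 / 25 * c3 n + 294 / 25 * c4 n
      + 2592 / 175 * atQuot c2 n 3 - 54 / 25 * atQuot c3 n 3
      - 5778 / 175 * atQuot c4 n 3
      + 18 / 125 * c5 n - 648 / 5 * c6 n + 2484 / 25 * c7 n + 882 / 125 * c8 n
      - 1296 / 25 * c10 n - 252 / 25 * c12 n + 972 / 7 * c17 n + 15552 / 175 * c19 n := by
  have hS := hasQExp_sigmaFun_scale
  have hC {f : ℍ → ℂ} (hf : IsModForm (CongruenceSubgroup.Gamma0 42) 4 f) :=
    hasQExp_of_isModForm_Gamma0 hf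
  have h6 := isModForm_etaC6.hasQExp T_mem_levelGroup
  have h7 := isModForm_etaC7.hasQExp T_mem_levelGroup
  have h12 := isModForm_etaC12.hasQExp T_mem_levelGroup
  have hr := (HasQExp.one.const_mul 875).add ((hS 1).const_mul 84)
    |>.add ((hS 2).const_mul 336) |>.add ((hS 3).const_mul 756) |>.add ((hS 6).const_mul 3024)
    |>.add ((hS 7).const_mul 4116) |>.add ((hS 14).const_mul 16464)
    |>.add ((hS 21).const_mul 37044) |>.add ((hS 42).const_mul 148176)
    |>.add ((hC isModForm_etaC2).const_mul 10080) |>.add ((hC isModForm_etaC3).const_mul (-210))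
    |>.add ((hC isModForm_etaC4).const_mul 10290)
    |>.add (((hC isModForm_etaC3).scale 3).const_mul (-1890))
    |>.add ((hC isModForm_etaC5).const_mul 126) |>.add (h6.const_mul (-113400))
    |>.add (h7.const_mul 86940) |>.add ((hC isModForm_etaC8).const_mul 6174)
    |>.add ((hC isModForm_etaC10).const_mul (-45360)) |>.add (h12.const_mul (-8820))
    |>.add ((hC isModForm_etaC17).const_mul 92610) |>.add ((hC isModForm_etaC19).const_mul 90720)
  have h := congrArg (PowerSeries.coeff n)
    (((hasQExp_octTheta.const_mul 875).congr octTheta_eq).unique hr)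
  have h1 : atQuot sigma3 n 1 = sigma3 n := by simp [atQuot]
  have hc3 : atQuot (fun m ↦ (UpperHalfPlane.qExpansion 1 etaC3).coeff m) n 3 = atQuot c3 n 3 := rfl
  -- Positivity of `n` removes the constant term `875 · 1`, which corresponds to the zero vector.
  simp only [map_add, PowerSeries.coeff_C_mul, PowerSeries.coeff_one, PowerSeries.coeff_mk,
    coeff_sigmaSeries, coeff_dilate, if_neg hn.ne', h1, hc3] at h
  -- After merging, the coefficients are `875 (2592 + 15552) / 175 = 90720` for `c₁₉` and `875
  -- (972/7 - 5778/175) = 92610` for `c₁₇`.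
  rw [atQuot_c2, atQuot_c4]
  simp only [c2, c3, c4, c5, c6, c7, c8, c10, c12, c17, c19, fourierCoeffAt] at h ⊢
  linear_combination h / 875
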